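/- Let $\Xi$ be a set, $n\ge 1$, $m\ge 0$, $A:\Xi\to\mathbb{R}^{n\times n}$, and let $\xi_1,\dots,\xi_m\in\Xi$ be points at which $A(\xi_i)$ is invertible. Put $Y_m=\mathrm{span}\{A(\xi_1)^{-1},\dots,A(\xi_m)^{-1}\}\subset\mathbb{R}^{n\times n}$, let $\xi\in\Xi$, and let $\|\cdot\|_F$ be the Frobenius norm. Let $0<\varepsilon\le 1$, $C>1$, $\delta>0$, and assume that $\varepsilon'=\varepsilon(C+1)/(C-1)<1$. Let $V$ be a random matrix in $\mathbb{R}^{n\times K}$ of one of the following two kinds. (a) $V$ is a rescaled Rademacher matrix, i.e. its entries are independent and equal to $\pm K^{-1/2}$ with probability $1/2$ each, and $$K\ge 6\,\varepsilon^{-2}\ln\!\big(2n(9C/\varepsilon)^{m+1}/\delta\big).$$ (b) $V$ is a P-SRHT matrix, i.e. with $s=2^{\lceil\log_2 n\rceil}$, $V$ consists of the first $n$ rows of $K^{-1/2}(RHD)^T\in\mathbb{R}^{s\times K}$, where $H$ is an $s\times s$ Hadamard matrix (entries $\pm1$, $HH^T=sI$), $D$ is a diagonal $s\times s$ matrix whose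 diagonal entries are independent and equal to $\pm1$ with probability $1/2$ each, and $R\in\mathbb{R}^{K\times s}$, independent of $D$, consists of $K$ rows of the $s\times s$ identity matrix drawn uniformly at random without replacement (so $K\le s$); and $$K\ge 2\,(\varepsilon^2-\varepsilon^3/3)^{-1}\ln\!\big(4(9C/\varepsilon)^{m+1}/\delta\big)\Big(1+\sqrt{8\ln\!\big(4n(9C/\varepsilon)^{m+1}/\delta\big)}\Big)^2.$$ Then $P\mapsto\|I-PA(\xi)\|_F$ attains its minimum over $Y_m$, and with probability at least $1-\delta$ the following holds: $P\mapsto\|(I-PA(\xi))V\|_F$ attains its minimum over $Y_m$, and every minimiser $P_m(\xi)\in Y_m$ of it satisfies $$\|I-P_m(\xi)A(\xi)\|_F\le\sqrt{\frac{1+\varepsilon'}{1-\varepsilon'}}\;\min_{P\in Y_m}\|I-PA(\xi)\|_F .$$ -/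

import Mathlib

open MeasureTheory ProbabilityTheory
open scoped Matrix Matrix.Norms.Frobenius ENNReal

noncomputable section

/-- The symmetric two-point law: mass `1/2` at `c` and mass `1/2` at `-c`. -/
def signLaw (c : ℝ) : Measure ℝ :=
  bernoulliMeasure c (-c) ⟨1 / 2, by norm_num, by norm_num⟩

/-- The rescaled Rademacher distribution on `n × K` arrays: the entries are independent, each
equal to `K^{-1/2}` or `-K^{-1/2}` with probability `1/2`. -/
def rademacherLaw (n K : ℕ) : Measure (Fin n → Fin K → ℝ) :=
  Measure.pi fun _ => Measure.pi fun _ => signLaw (√(K : ℝ))⁻¹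

/-- The matrix `K^{-1/2} (R H D)ᵀ`, where `D` is the diagonal matrix with diagonal `d` and `R` is
the `K × s` matrix whose `k`-th row is the `r k`-th row of the identity matrix. -/
def srhtMatrix {s K : ℕ} (H : Matrix (Fin s) (Fin s) ℝ) (d : Fin s → ℝ) (r : Fin K → Fin s) :
    Matrix (Fin s) (Fin K) ℝ :=
  (√(K : ℝ))⁻¹ • ((1 : Matrix (Fin s) (Fin s) ℝ).submatrix r id * H * Matrix.diagonal d)ᵀ

/-- The SRHT distribution of size `s × K` built on `H`: in `srhtMatrix H d r` the entries of `d` are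
independent random signs, and, independently of `d`, the `K` rows selected by `r` are drawn
uniformly at random without replacement (so `r` is uniform on the injections). -/
def srhtLaw {s : ℕ} (K : ℕ) (H : Matrix (Fin s) (Fin s) ℝ) : Measure (Fin s → Fin K → ℝ) :=
  ((Measure.pi fun _ : Fin s => signLaw 1).prod
    (uniformOn {r : Fin K → Fin s | Function.Injective r})).map
      fun p i k => srhtMatrix H p.1 p.2 i k

/-- The smallest power of two that is at least `n`. -/
def padSize (n : ℕ) : ℕ := 2 ^ Nat.clog 2 n

theorem le_padSize (n : ℕ) : n ≤ padSize n := Nat.le_pow_clog one_lt_two n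

/-- The P-SRHT distribution on `n × K` arrays: the first `n` rows of an SRHT matrix of size
`s × K`, where `s = padSize n`. -/
def psrhtLaw (n K : ℕ) (H : Matrix (Fin (padSize n)) (Fin (padSize n)) ℝ) :
    Measure (Fin n → Fin K → ℝ) :=
  (srhtLaw K H).map fun W i k => W (Fin.castLE (le_padSize n) i) k

/-- `V` is a rescaled Rademacher random matrix. -/
def IsRademacherMatrix {n K : ℕ} {Ω : Type*} [MeasurableSpace Ω] (μ : Measure Ω)
    (V : Ω → Matrix (Fin n) (Fin K) ℝ) : Prop :=
  HasLaw (fun ω i k => V ω i k) (rademacherLaw n K) μ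

/-- `V` is a P-SRHT random matrix, for some Hadamard matrix of the relevant size. -/
def IsPSRHTMatrix {n K : ℕ} {Ω : Type*} [MeasurableSpace Ω] (μ : Measure Ω)
    (V : Ω → Matrix (Fin n) (Fin K) ℝ) : Prop :=
  ∃ H : Matrix (Fin (padSize n)) (Fin (padSize n)) ℝ,
    H.IsHadamard ∧ HasLaw (fun ω i k => V ω i k) (psrhtLaw n K H) μ

/-- `Y_m`, the linear span of the matrices `A(ξ₁)⁻¹, …, A(ξ_m)⁻¹`. -/
def interpSpace {Ξ : Type*} {n m : ℕ} (A : Ξ → Matrix (Fin n) (Fin n) ℝ) (pts : Fin m → Ξ) :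
    Submodule ℝ (Matrix (Fin n) (Fin n) ℝ) :=
  Submodule.span ℝ (Set.range fun i => (A (pts i))⁻¹)

/-- `P` minimises the Frobenius norm `‖I - P A‖` over the subspace `Y`. -/
def IsFrobProjection {n : ℕ} (Y : Submodule ℝ (Matrix (Fin n) (Fin n) ℝ))
    (A P : Matrix (Fin n) (Fin n) ℝ) : Prop :=
  P ∈ Y ∧ ∀ Q ∈ Y, ‖1 - P * A‖ ≤ ‖1 - Q * A‖

/-- `P` minimises the Frobenius semi-norm `‖(I - P A) V‖` over the subspace `Y`. -/
def IsSemiFrobProjection {n K : ℕ} (Y : Submodule ℝ (Matrix (Fin n) (Fin n) ℝ))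
    (A : Matrix (Fin n) (Fin n) ℝ) (V : Matrix (Fin n) (Fin K) ℝ)
    (P : Matrix (Fin n) (Fin n) ℝ) : Prop :=
  P ∈ Y ∧ ∀ Q ∈ Y, ‖(1 - P * A) * V‖ ≤ ‖(1 - Q * A) * V‖

end

/-!
The residuals `I - P A(ξ)`, `P ∈ Y_m`, lie in a space `S` of matrices of dimension at most `m + 1`.
If the sketch `X ↦ X V` keeps the squared Frobenius norm of every matrix of a net of the unit sphere
of `S`, and of the optimal residual, within `[1 - β, 1 + α]` times its value, then it is bounded
below on all of `S` (`lower_bound_of_net`): the upper control on the net bounds the operator norm of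
the sketch, which pays for the distance to the net. A minimiser of the sketched residual has a
sketched norm at most that of the optimal residual, so its true norm is at most a constant times the
optimal one (`norm_le_of_sketchBounds`). With mesh `ε / (3 C)` the constant is the claimed one as
soon as `(1 + α) (1 - ε) ≤ (1 + ε) (1 - β)` (`quasi_optimality_constant`), and a volume bound gives
such a net which, with the optimal residual, has at most `(9 C / ε) ^ (m + 1)` elements. A union
bound reduces everything to one fixed matrix `X` with `‖X‖ = 1`
(`exists_sketchBounds_le`).

For one matrix, everything rests on exponential moments of `‖B d‖²`, with `d` a vector of random
signs and `‖B‖ = 1`. By convexity of the exponential it suffices to treat one unit row `u`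
(`expect_exp_quadratic_le`). An independent standard Gaussian `g` linearises the square,
`exp (t (u · d)²) = 𝔼 exp (√(2 t) g (u · d))`, and `cosh x ≤ exp (x² / 2)` then gives the Gaussian
bound `(1 - 2 t)^(-1/2)` (`expect_exp_sq_le`). Negative exponents are handled by the fourth moment
(`expect_exp_neg_sq_le`).

* Rademacher sketch: the columns are independent, so Chernoff's method applies. The lower tail is
  lighter than the upper one, and for `ε` close to `1` the upper tail bound at `α = ε` is too
  weak for the sampling condition; `α = 7 ε / 6`, `β = ε (5 + ε) / 6` is a choice that works.
* P-SRHT sketch: after the random signs, no column of the transformed matrix has squared norm above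
  `(1 + τ)²` times the average, except with small probability (`unifProb_norm_tail`). The sketched
  norm is then an average of bounded numbers sampled without replacement. Its exponential moments
  are at most those of independent sampling (`expect_injective_prod_le`), and Chernoff's bound
  applies (`unifProb_sampling_distortion`).

All laws are images of uniform distributions on finite types, so the probabilistic part is carried
out with finite averages `𝔼`.
-/

namespace RandomSketch

open Finset BigOperators

/-! ### Uniform averages over finite types -/

/-- The probability of the event `p` under the uniform distribution on a finite type. -/
noncomputable def unifProb {α : Type*} [Fintype α] (p : α → Prop) : ℝ :=
  open Classical in 𝔼 x, if p x then 1 else 0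

section Prob

variable {α β : Type*} [Fintype α] [Fintype β]

theorem unifProb_mono {p q : α → Prop} (h : ∀ x, p x → q x) : unifProb p ≤ unifProb q := by
  refine expect_le_expect fun x _ => ?_
  have := h x
  by_cases hp : p x
  · simp [hp, this hp]
  · simp only [hp, if_false]
    split_ifs <;> norm_num

theorem unifProb_or_le (p q : α → Prop) :
    unifProb (fun x => p x ∨ q x) ≤ unifProb p + unifProb q := by
  rw [unifProb, unifProb, unifProb, ← expect_add_distrib]
  refine expect_le_expect fun x _ => ?_
  by_cases hp : p x <;> by_cases hq : q x <;> simp [hp, hq]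

theorem unifProb_exists_le {ι : Type*} [Fintype ι] (p : ι → α → Prop) :
    unifProb (fun x => ∃ i, p i x) ≤ ∑ i, unifProb (p i) := by
  classical
  simp only [unifProb]
  rw [← expect_sum_comm]
  refine expect_le_expect fun x _ => ?_
  split_ifs with h
  · obtain ⟨i, hi⟩ := h
    calc (1 : ℝ) = if p i x then 1 else 0 := by simp [hi]
      _ ≤ ∑ j, if p j x then (1 : ℝ) else 0 :=
        single_le_sum (f := fun j => if p j x then (1 : ℝ) else 0)
          (fun j _ => by split_ifs <;> norm_num) (mem_univ i)
  · exact sum_nonneg fun j _ => by split_ifs <;> norm_num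

/-- Markov's inequality: if `F ≥ 0` everywhere and `F ≥ 1` on the event, then the average of `F`
bounds the probability of the event. -/
theorem unifProb_le_expect (p : α → Prop) (F : α → ℝ) (h0 : ∀ x, 0 ≤ F x)
    (h1 : ∀ x, p x → 1 ≤ F x) : unifProb p ≤ 𝔼 x, F x := by
  refine expect_le_expect fun x _ => ?_
  split_ifs with h
  · exact h1 x h
  · exact h0 x

/-- Conditioning on the first coordinate: outside an event `q` the conditional probability of `p`
is at most `c`. -/
theorem unifProb_prod_le (p : α × β → Prop) (q : α → Prop) {c : ℝ} (hc : 0 ≤ c)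
    (h : ∀ a, ¬ q a → unifProb (fun b => p (a, b)) ≤ c) :
    unifProb p ≤ unifProb q + c := by
  classical
  have key : unifProb p = 𝔼 a, unifProb (fun b => p (a, b)) := by
    simp only [unifProb]
    rw [← univ_product_univ, expect_product]
  rw [key]
  calc 𝔼 a, unifProb (fun b => p (a, b)) ≤ 𝔼 a, ((if q a then (1 : ℝ) else 0) + c) := by
        refine expect_le_expect fun a _ => ?_
        by_cases hq : q a
        · simp only [hq, if_true]
          have : unifProb (fun b => p (a, b)) ≤ 1 := by
            rcases isEmpty_or_nonempty β with hβ | hβ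
            · simp [unifProb]
            · calc _ ≤ 𝔼 _b : β, (1 : ℝ) :=
                    expect_le_expect fun x _ => by split_ifs <;> norm_num
                _ = 1 := by simp
          linarith
        · simpa [hq] using h a hq
    _ ≤ unifProb q + c := by
        rw [expect_add_distrib]
        refine add_le_add le_rfl ?_
        rcases isEmpty_or_nonempty α with hα | hα
        · simpa using hc
        · simp

/-- Independence: the average of a product over a product space factorises. -/
theorem expect_prod_pi {ι : Type*} [Fintype ι] [DecidableEq ι] (f : ι → α → ℝ) :
    𝔼 b : ι → α, ∏ i, f i (b i) = ∏ i, 𝔼 a, f i a := by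
  simp only [Fintype.expect_eq_sum_div_card]
  rw [prod_div_distrib, Fintype.prod_sum]
  simp

end Prob

/-! ### Random signs -/

/-- The sign `±1` encoded by a Boolean. -/
def sgn (b : Bool) : ℝ := if b then 1 else -1

theorem sgn_sq (b : Bool) : sgn b ^ 2 = 1 := by cases b <;> simp [sgn]

theorem sgn_not (b : Bool) : sgn (!b) = -sgn b := by cases b <;> simp [sgn]

section Signs

variable {ι : Type*} [Fintype ι] [DecidableEq ι]

/-- Random signs are sub-Gaussian, by `cosh x ≤ exp (x² / 2)`. -/
theorem expect_exp_sum_le (u : ι → ℝ) :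
    𝔼 d : ι → Bool, Real.exp (∑ i, u i * sgn (d i)) ≤ Real.exp ((∑ i, u i ^ 2) / 2) := by
  have h1 : ∀ d : ι → Bool, Real.exp (∑ i, u i * sgn (d i)) =
      ∏ i, Real.exp (u i * sgn (d i)) := fun d => Real.exp_sum _ _
  simp only [h1]
  rw [expect_prod_pi (fun i a => Real.exp (u i * sgn a)), sum_div, Real.exp_sum]
  refine prod_le_prod (fun i _ => expect_nonneg fun _ _ => (Real.exp_pos _).le) fun i _ => ?_
  have : 𝔼 a, Real.exp (u i * sgn a) = Real.cosh (u i) := by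
    rw [Fintype.expect_eq_sum_div_card, Real.cosh_eq]
    simp [sgn]
  rw [this]
  exact Real.cosh_le_exp_half_sq _

/-- A linear form in random signs is dominated by a Gaussian in the sense of the moment generating
function of its square. A Gaussian variable independent of the signs linearises the square. -/
theorem expect_exp_sq_le (u : ι → ℝ) (hu : ∑ i, u i ^ 2 = 1) {t : ℝ} (ht0 : 0 ≤ t)
    (ht : t < 1 / 2) :
    𝔼 d : ι → Bool, Real.exp (t * (∑ i, u i * sgn (d i)) ^ 2) ≤ (√(1 - 2 * t))⁻¹ := by
  set c := √(2 * t) with hc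
  have hc2 : c ^ 2 = 2 * t := Real.sq_sqrt (by linarith)
  -- The moment generating function of a standard Gaussian linearises the square.
  have hG : ∀ y : ℝ, Real.exp (t * y ^ 2) =
      ∫ x, Real.exp (c * y * x) ∂(gaussianReal 0 1) := by
    intro y
    have := mgf_gaussianReal (p := gaussianReal 0 1) (X := id) (μ := 0) (v := 1)
      (by simp) (c * y)
    simp only [mgf, id] at this
    rw [this]
    congr 1
    simp [mul_pow, hc2]
    ring
  have hI : ∀ y : ℝ, Integrable (fun x => Real.exp (c * y * x)) (gaussianReal 0 1) := fun y =>
    integrable_exp_mul_gaussianReal (c * y)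
  -- Averaging over the signs first leaves a Gaussian integral.
  have hpt : ∀ x : ℝ, 𝔼 d : ι → Bool, Real.exp (c * (∑ i, u i * sgn (d i)) * x) ≤
      Real.exp (t * x ^ 2) := by
    intro x
    have := expect_exp_sum_le (fun i => c * x * u i)
    have h2 : ∑ i, (c * x * u i) ^ 2 / 2 = t * x ^ 2 := by
      rw [← sum_div]
      simp only [mul_pow]
      rw [← mul_sum, hu, hc2]; ring
    rw [sum_div, h2] at this
    refine le_trans (le_of_eq ?_) this
    refine expect_congr rfl fun d _ => ?_
    congr 1
    rw [mul_sum, sum_mul]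
    exact sum_congr rfl fun i _ => by ring
  have hint : Integrable (fun x => Real.exp (t * x ^ 2)) (gaussianReal 0 1) ∧
      ∫ x, Real.exp (t * x ^ 2) ∂(gaussianReal 0 1) = (√(1 - 2 * t))⁻¹ := by
    have hb : 0 < 1 / 2 - t := by linarith
    have hd : ∀ x : ℝ, gaussianPDFReal 0 1 x • Real.exp (t * x ^ 2) =
        (√(2 * Real.pi))⁻¹ * Real.exp (-(1 / 2 - t) * x ^ 2) := by
      intro x
      simp only [gaussianPDFReal, smul_eq_mul, NNReal.coe_one, mul_one, sub_zero]
      rw [mul_assoc, ← Real.exp_add]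
      congr 2; ring
    constructor
    · rw [gaussianReal_of_var_ne_zero _ one_ne_zero,
        integrable_withDensity_iff_integrable_smul₀' (by fun_prop)
          (by simp [gaussianPDF])]
      simp only [gaussianPDF, ENNReal.toReal_ofReal (gaussianPDFReal_nonneg _ _ _), hd]
      exact (integrable_exp_neg_mul_sq hb).const_mul _
    · rw [integral_gaussianReal_eq_integral_smul one_ne_zero]
      simp only [hd]
      rw [integral_const_mul, integral_gaussian, ← Real.sqrt_inv, ← Real.sqrt_inv,
        ← Real.sqrt_mul (by positivity)]
      congr 1
      have : (1 - 2 * t) ≠ 0 := by linarith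
      have : (1 / 2 - t) ≠ 0 := hb.ne'
      field_simp
  calc 𝔼 d : ι → Bool, Real.exp (t * (∑ i, u i * sgn (d i)) ^ 2)
      = 𝔼 d : ι → Bool, ∫ x, Real.exp (c * (∑ i, u i * sgn (d i)) * x) ∂(gaussianReal 0 1) :=
        expect_congr rfl fun d _ => hG _
    _ = ∫ x, 𝔼 d : ι → Bool, Real.exp (c * (∑ i, u i * sgn (d i)) * x) ∂(gaussianReal 0 1) := by
        simp only [Fintype.expect_eq_sum_div_card]
        rw [integral_div, integral_finsetSum _ fun d _ => hI _]
    _ ≤ ∫ x, Real.exp (t * x ^ 2) ∂(gaussianReal 0 1) := by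
        refine integral_mono ?_ hint.1 hpt
        simp only [Fintype.expect_eq_sum_div_card]
        exact (integrable_finsetSum _ fun d _ => hI _).div_const _
    _ = _ := hint.2

/-- A function of signs that is odd in one of them averages to zero. -/
theorem expect_eq_zero_of_odd (a : ι) (F : (ι → Bool) → ℝ)
    (hF : ∀ d, F (Function.update d a (!d a)) = -F d) : 𝔼 d, F d = 0 := by
  have hinv : Function.Involutive fun d : ι → Bool => Function.update d a (!d a) := by
    intro d; simp
  have := Fintype.expect_equiv hinv.toPerm (fun d => F d) (fun d => -F d)
    (fun d => by simp [Function.Involutive.coe_toPerm, hF])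
  rw [expect_neg_distrib] at this
  linarith

/-- Second and fourth moments of a linear form in random signs, by adding one sign at a time: the
terms odd in the new sign vanish. -/
theorem expect_sq_four_sum (u : ι → ℝ) (S : Finset ι) :
    𝔼 d : ι → Bool, (∑ i ∈ S, u i * sgn (d i)) ^ 2 = ∑ i ∈ S, u i ^ 2 ∧
    𝔼 d : ι → Bool, (∑ i ∈ S, u i * sgn (d i)) ^ 4 ≤ 3 * (∑ i ∈ S, u i ^ 2) ^ 2 := by
  induction S using Finset.induction_on with
  | empty => simp
  | insert a S ha ih =>
    set L : (ι → Bool) → ℝ := fun d => ∑ i ∈ S, u i * sgn (d i) with hL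
    have hLu : ∀ d, L (Function.update d a (!d a)) = L d := by
      intro d
      refine sum_congr rfl fun i hi => ?_
      rw [Function.update_of_ne (by rintro rfl; exact ha hi)]
    have odd : ∀ k : ℕ, 𝔼 d, L d ^ k * sgn (d a) = 0 := by
      intro k
      refine expect_eq_zero_of_odd a _ fun d => ?_
      rw [hLu]; simp [sgn_not]
    simp only [sum_insert ha]
    have e2 : ∀ d : ι → Bool, (u a * sgn (d a) + L d) ^ 2 =
        u a ^ 2 + (2 * u a) * (L d ^ 1 * sgn (d a)) + L d ^ 2 := by
      intro d; linear_combination u a ^ 2 * sgn_sq (d a)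
    have e4 : ∀ d : ι → Bool, (u a * sgn (d a) + L d) ^ 4 =
        u a ^ 4 + (4 * u a ^ 3) * (L d ^ 1 * sgn (d a)) + (6 * u a ^ 2) * L d ^ 2 +
          (4 * u a) * (L d ^ 3 * sgn (d a)) + L d ^ 4 := by
      intro d
      linear_combination (u a ^ 4 * (sgn (d a) ^ 2 + 1) + 4 * u a ^ 3 * L d * sgn (d a) +
        6 * u a ^ 2 * L d ^ 2) * sgn_sq (d a)
    constructor
    · change 𝔼 d : ι → Bool, (u a * sgn (d a) + L d) ^ 2 = _
      simp only [e2]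
      rw [expect_add_distrib, expect_add_distrib, ← mul_expect, odd, ih.1]
      simp
    · change 𝔼 d : ι → Bool, (u a * sgn (d a) + L d) ^ 4 ≤ _
      simp only [e4]
      rw [expect_add_distrib, expect_add_distrib, expect_add_distrib, expect_add_distrib,
        ← mul_expect, ← mul_expect, ← mul_expect, odd, odd, ih.1]
      have := ih.2
      simp only [Fintype.expect_const]
      nlinarith [sq_nonneg (u a ^ 2)]

/-- Lower-tail counterpart of `expect_exp_sq_le`, from the fourth moment bound. -/
theorem expect_exp_neg_sq_le (u : ι → ℝ) (hu : ∑ i, u i ^ 2 = 1) {t : ℝ} (ht0 : 0 ≤ t) :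
    𝔼 d : ι → Bool, Real.exp (-t * (∑ i, u i * sgn (d i)) ^ 2) ≤ 1 - t + 3 / 2 * t ^ 2 := by
  have hexp : ∀ y : ℝ, 0 ≤ y → Real.exp (-y) ≤ 1 - y + y ^ 2 / 2 := by
    intro y hy
    have h1 := Real.quadratic_le_exp_of_nonneg hy
    rw [Real.exp_neg, inv_le_iff_one_le_mul₀ (Real.exp_pos _)]
    have h2 : 0 ≤ 1 - y + y ^ 2 / 2 := by nlinarith [sq_nonneg (y - 1)]
    calc (1 : ℝ) ≤ (1 - y + y ^ 2 / 2) * (1 + y + y ^ 2 / 2) := by nlinarith [sq_nonneg (y ^ 2)]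
      _ ≤ _ := mul_le_mul_of_nonneg_left h1 h2
  obtain ⟨h2, h4⟩ := expect_sq_four_sum u univ
  rw [hu] at h2 h4
  calc _ ≤ 𝔼 d : ι → Bool, (1 - t * (∑ i, u i * sgn (d i)) ^ 2 +
          t ^ 2 / 2 * (∑ i, u i * sgn (d i)) ^ 4) := by
        refine expect_le_expect fun d _ => ?_
        have := hexp (t * (∑ i, u i * sgn (d i)) ^ 2) (by positivity)
        rw [← neg_mul] at this
        refine this.trans (le_of_eq (by ring))
    _ ≤ _ := by
        rw [expect_add_distrib, expect_sub_distrib, ← mul_expect, ← mul_expect, h2]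
        simp only [Fintype.expect_const]
        nlinarith [sq_nonneg t]

/-- A bound on the exponential moments of squares of normalised linear forms in random signs passes
to sums of such squares with total weight one, by convexity of the exponential. -/
theorem expect_exp_quadratic_le {ρ : Type*} [Fintype ρ] (B : ρ → ι → ℝ)
    (hB : ∑ r, ∑ i, B r i ^ 2 = 1) {c M : ℝ}
    (h : ∀ u : ι → ℝ, ∑ i, u i ^ 2 = 1 →
      𝔼 d : ι → Bool, Real.exp (c * (∑ i, u i * sgn (d i)) ^ 2) ≤ M) :
    𝔼 d : ι → Bool, Real.exp (c * ∑ r, (∑ i, B r i * sgn (d i)) ^ 2) ≤ M := by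
  -- The squared row norms are the weights of the convex combination; a zero row gets the value `0`
  -- from the convention `0 / 0 = 0`, with weight `0`.
  set p : ρ → ℝ := fun r => ∑ i, B r i ^ 2 with hp
  have hp0 : ∀ r, 0 ≤ p r := fun r => sum_nonneg fun i _ => sq_nonneg _
  set L : ρ → (ι → Bool) → ℝ := fun r d => ∑ i, B r i * sgn (d i) with hL
  have hz : ∀ r, p r = 0 → ∀ d, L r d = 0 := by
    intro r hr d
    refine sum_eq_zero fun i hi => ?_
    have := (sum_eq_zero_iff_of_nonneg (fun i _ => sq_nonneg (B r i))).1 hr i hi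
    simp [pow_eq_zero_iff] at this
    simp [this]
  calc 𝔼 d : ι → Bool, Real.exp (c * ∑ r, L r d ^ 2)
      ≤ 𝔼 d : ι → Bool, ∑ r, p r * Real.exp (c * (L r d ^ 2 / p r)) := by
        refine expect_le_expect fun d _ => ?_
        have := convexOn_exp.map_sum_le (t := univ) (w := p) (p := fun r => c * (L r d ^ 2 / p r))
          (fun r _ => hp0 r) hB (fun _ _ => Set.mem_univ _)
        simp only [smul_eq_mul] at this
        refine le_trans (le_of_eq ?_) this
        congr 1
        rw [mul_sum]
        refine sum_congr rfl fun r _ => ?_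
        by_cases hr : p r = 0
        · simp [hr, hz r hr d]
        · field_simp
    _ = ∑ r, p r * 𝔼 d : ι → Bool, Real.exp (c * (L r d ^ 2 / p r)) := by
        rw [expect_sum_comm]
        exact sum_congr rfl fun r _ => (mul_expect _ _ _).symm
    _ ≤ ∑ r, p r * M := by
        refine sum_le_sum fun r _ => ?_
        by_cases hr : p r = 0
        · simp [hr]
        refine mul_le_mul_of_nonneg_left ?_ (hp0 r)
        have hs : √(p r) ^ 2 = p r := Real.sq_sqrt (hp0 r)
        have := h (fun i => B r i / √(p r)) (by
          simp only [div_pow, hs]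
          rw [← sum_div]
          exact div_self hr)
        refine le_trans (le_of_eq ?_) this
        refine expect_congr rfl fun d _ => ?_
        congr 2
        simp only [div_mul_eq_mul_div]
        rw [← sum_div, div_pow, hs]
    _ = M := by rw [← sum_mul, hB, one_mul]

end Signs

/-! ### Elementary inequalities for the tail exponents -/

/-- The upper-tail exponent at distortion `7 x / 6` is at least the exponent `x ^ 2 / 6` that the
sampling condition provides. -/
theorem third_sq_le_sub_log {x : ℝ} (h0 : 0 ≤ x) (h1 : x ≤ 1) :
    x ^ 2 / 3 ≤ 7 / 6 * x - Real.log (1 + 7 / 6 * x) := by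
  have hy : 0 ≤ 7 / 6 * x - x ^ 2 / 3 := by nlinarith
  have h := Real.quadratic_le_exp_of_nonneg hy
  have h3 : 1 + 7 / 6 * x ≤ Real.exp (7 / 6 * x - x ^ 2 / 3) := by
    have h4 : 5 / 6 * x ≤ 7 / 6 * x - x ^ 2 / 3 := by nlinarith
    have h5 : (5 / 6 * x) ^ 2 ≤ (7 / 6 * x - x ^ 2 / 3) ^ 2 :=
      pow_le_pow_left₀ (by linarith) h4 2
    nlinarith [sq_nonneg x]
  have := (Real.log_le_iff_le_exp (by linarith)).2 h3
  linarith

theorem one_sub_le_exp_neg_sub_sq {x : ℝ} (h0 : 0 ≤ x) (h1 : x < 1) :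
    1 - x ≤ Real.exp (-x - x ^ 2 / 2) := by
  have h := Real.hasSum_pow_div_log_of_abs_lt_one (x := x) (by rwa [abs_of_nonneg h0])
  have h2 := sum_le_hasSum (range 2) (fun i _ => by positivity) h
  simp [sum_range_succ] at h2
  rw [← Real.log_le_iff_le_exp (by linarith)]
  norm_num at h2
  linarith

/-- The Chernoff bound for the lower tail with parameter `x / 3`, at distortion
`x (5 + x) / 6`. The second-order term of `log (1 - y)` pays for this distortion being
smaller than `x`. -/
theorem lower_tail_exponent {x : ℝ} (h0 : 0 ≤ x) (h1 : x ≤ 1) :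
    Real.exp (x / 3 * (1 - x * (5 + x) / 6)) * (1 - x / 3 + 3 / 2 * (x / 3) ^ 2) ≤
      Real.exp (-(x ^ 2 / 6)) := by
  have hy0 : 0 ≤ x / 3 - x ^ 2 / 6 := by nlinarith
  have h := one_sub_le_exp_neg_sub_sq hy0 (by nlinarith)
  have e : 1 - x / 3 + 3 / 2 * (x / 3) ^ 2 = 1 - (x / 3 - x ^ 2 / 6) := by ring
  rw [e]
  refine (mul_le_mul_of_nonneg_left h (Real.exp_pos _).le).trans ?_
  rw [← Real.exp_add, Real.exp_le_exp]
  have : 0 ≤ x ^ 4 := by positivity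
  nlinarith

theorem le_one_add_mul_log {x : ℝ} (h0 : 0 ≤ x) :
    x ^ 2 / 2 - x ^ 3 / 6 ≤ (1 + x) * Real.log (1 + x) - x := by
  have hlog : ∀ y : ℝ, 0 ≤ y → y - y ^ 2 / 2 ≤ Real.log (1 + y) := by
    intro y hy
    refine le_trans ?_ (Real.le_log_one_add_of_nonneg hy)
    rw [le_div_iff₀ (by linarith)]
    nlinarith [pow_nonneg hy 3]
  -- The difference of the two sides vanishes at `0` and has nonnegative derivative.
  let f : ℝ → ℝ := fun y => (1 + y) * Real.log (1 + y) - y - (y ^ 2 / 2 - y ^ 3 / 6)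
  have hd : ∀ y : ℝ, 0 ≤ y → HasDerivAt f (Real.log (1 + y) - (y - y ^ 2 / 2)) y := by
    intro y hy
    have hne : (1 + y) ≠ 0 := by linarith
    have h1 : HasDerivAt (fun y : ℝ => 1 + y) 1 y := (hasDerivAt_id y).const_add 1
    have h2 := (h1.mul (h1.log hne)).sub (hasDerivAt_id y)
    have h3 := ((hasDerivAt_pow 2 y).div_const 2).sub ((hasDerivAt_pow 3 y).div_const 6)
    convert! h2.sub h3 using 1
    field_simp
    norm_num
    ring
  have hmono : MonotoneOn f (Set.Ici 0) := by
    refine monotoneOn_of_hasDerivWithinAt_nonneg (convex_Ici 0)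
      (fun y hy => (hd y hy).continuousAt.continuousWithinAt)
      (f' := fun y => Real.log (1 + y) - (y - y ^ 2 / 2)) (fun y hy => ?_) (fun y hy => ?_)
    · rw [interior_Ici] at hy
      exact (hd y (le_of_lt hy)).hasDerivWithinAt
    · rw [interior_Ici] at hy
      have := hlog y (le_of_lt hy)
      linarith
  have := hmono (Set.mem_Ici.2 le_rfl) (Set.mem_Ici.2 h0) h0
  simp [f] at this
  linarith

theorem le_one_sub_mul_log {x : ℝ} (h1 : x < 1) (h0 : 0 ≤ x) :
    x ^ 2 / 2 ≤ (1 - x) * Real.log (1 - x) + x := by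
  have hp : 0 < 1 - x := by linarith
  -- With `v = -log (1 - x)`, this is `v ≤ sinh v`.
  have h : -Real.log (1 - x) ≤ Real.sinh (-Real.log (1 - x)) :=
    Real.self_le_sinh_iff.2 (by
      have := Real.log_nonpos hp.le (by linarith)
      linarith)
  rw [Real.sinh_neg, Real.sinh_log hp] at h
  have h2 := mul_le_mul_of_nonneg_left h hp.le
  have e : (1 - x) * -((1 - x - (1 - x)⁻¹) / 2) = x - x ^ 2 / 2 := by
    field_simp
    ring
  rw [e] at h2
  linarith

/-! ### Concentration of the Rademacher sketch -/

section Rademacher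

variable {ρ ι : Type*} [Fintype ρ] [Fintype ι] [DecidableEq ι]

/-- The columns of a matrix of independent signs are independent. -/
theorem expect_exp_sum_columns (K : ℕ) (q : (ι → Bool) → ℝ) (c : ℝ) :
    𝔼 b : ι → Fin K → Bool, Real.exp (c * ∑ k, q fun i => b i k) =
      (𝔼 d, Real.exp (c * q d)) ^ K := by
  have h := Fintype.expect_equiv (Equiv.piComm fun (_ : ι) (_ : Fin K) => Bool)
    (fun b => Real.exp (c * ∑ k, q fun i => b i k)) (fun b => ∏ k, Real.exp (c * q (b k)))
    (fun b => by rw [mul_sum, Real.exp_sum]; rfl)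
  rw [h, expect_prod_pi (fun _ d => Real.exp (c * q d))]
  simp

theorem unifProb_quadratic_upper (B : ρ → ι → ℝ) (hB : ∑ r, ∑ i, B r i ^ 2 = 1) (K : ℕ)
    {a : ℝ} (ha : 0 ≤ a) :
    unifProb (fun b : ι → Fin K → Bool =>
      K * (1 + a) < ∑ k, ∑ r, (∑ i, B r i * sgn (b i k)) ^ 2) ≤
      Real.exp (-(K * ((a - Real.log (1 + a)) / 2))) := by
  have h1a : 0 < 1 + a := by linarith
  -- The optimal Chernoff parameter, for which `1 - 2 t = 1 / (1 + a)`.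
  set t := a / (2 * (1 + a)) with ht
  have ht0 : 0 ≤ t := by positivity
  have ht2 : 1 - 2 * t = (1 + a)⁻¹ := by rw [ht]; field_simp; ring
  have htl : t < 1 / 2 := by
    have : 0 < (1 + a)⁻¹ := by positivity
    linarith
  have hta : t * (1 + a) = a / 2 := by rw [ht]; field_simp
  have hM := expect_exp_quadratic_le B hB (fun u hu => expect_exp_sq_le u hu ht0 htl)
  refine (unifProb_le_expect _ (fun b => Real.exp (-(t * (K * (1 + a)))) *
    Real.exp (t * ∑ k, ∑ r, (∑ i, B r i * sgn (b i k)) ^ 2)) (fun b => by positivity)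
    (fun b hb => ?_)).trans ?_
  · rw [← Real.exp_add]
    refine Real.one_le_exp ?_
    have := mul_le_mul_of_nonneg_left hb.le ht0
    linarith
  · rw [← mul_expect, expect_exp_sum_columns K (fun d => ∑ r, (∑ i, B r i * sgn (d i)) ^ 2) t]
    have h2 : (√(1 - 2 * t))⁻¹ = Real.exp (Real.log (1 + a) / 2) := by
      rw [ht2, Real.sqrt_inv, inv_inv, Real.exp_half, Real.exp_log h1a]
    rw [h2] at hM
    refine (mul_le_mul_of_nonneg_left (pow_le_pow_left₀
      (expect_nonneg fun _ _ => (Real.exp_pos _).le) hM K) (Real.exp_pos _).le).trans ?_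
    rw [← Real.exp_nat_mul, ← Real.exp_add, Real.exp_le_exp]
    have : t * (K * (1 + a)) = K * (a / 2) := by rw [← hta]; ring
    rw [this]
    linarith

theorem unifProb_quadratic_lower (B : ρ → ι → ℝ) (hB : ∑ r, ∑ i, B r i ^ 2 = 1) (K : ℕ)
    {x : ℝ} (hx0 : 0 ≤ x) (hx1 : x ≤ 1) :
    unifProb (fun b : ι → Fin K → Bool =>
      ∑ k, ∑ r, (∑ i, B r i * sgn (b i k)) ^ 2 < K * (1 - x * (5 + x) / 6)) ≤
      Real.exp (-(K * (x ^ 2 / 6))) := by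
  have ht0 : 0 ≤ x / 3 := by linarith
  have hM := expect_exp_quadratic_le B hB (fun u hu => expect_exp_neg_sq_le u hu ht0)
  refine (unifProb_le_expect _ (fun b => Real.exp (K * (x / 3 * (1 - x * (5 + x) / 6))) *
    Real.exp (-(x / 3) * ∑ k, ∑ r, (∑ i, B r i * sgn (b i k)) ^ 2)) (fun b => by positivity)
    (fun b hb => ?_)).trans ?_
  · rw [← Real.exp_add]
    refine Real.one_le_exp ?_
    have := mul_le_mul_of_nonneg_left hb.le ht0
    linarith
  · rw [← mul_expect,
      expect_exp_sum_columns K (fun d => ∑ r, (∑ i, B r i * sgn (d i)) ^ 2) (-(x / 3))]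
    refine (mul_le_mul_of_nonneg_left (pow_le_pow_left₀
      (expect_nonneg fun _ _ => (Real.exp_pos _).le) hM K) (Real.exp_pos _).le).trans ?_
    rw [Real.exp_nat_mul, ← mul_pow, ← mul_neg, Real.exp_nat_mul]
    refine pow_le_pow_left₀ ?_ (lower_tail_exponent hx0 hx1) K
    have := (expect_nonneg (s := univ) fun (d : ι → Bool) _ =>
      (Real.exp_pos (-(x / 3) * ∑ r, (∑ i, B r i * sgn (d i)) ^ 2)).le).trans hM
    positivity

theorem unifProb_rademacher_distortion (B : ρ → ι → ℝ) (hB : ∑ r, ∑ i, B r i ^ 2 = 1) (K : ℕ)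
    {x : ℝ} (hx0 : 0 ≤ x) (hx1 : x ≤ 1) :
    unifProb (fun b : ι → Fin K → Bool =>
      ¬ (K * (1 - x * (5 + x) / 6) ≤ ∑ k, ∑ r, (∑ i, B r i * sgn (b i k)) ^ 2 ∧
        ∑ k, ∑ r, (∑ i, B r i * sgn (b i k)) ^ 2 ≤ K * (1 + 7 / 6 * x))) ≤
      2 * Real.exp (-(K * (x ^ 2 / 6))) := by
  have hu := unifProb_quadratic_upper B hB K (a := 7 / 6 * x) (by linarith)
  have hl := unifProb_quadratic_lower B hB K hx0 hx1
  have hu' : Real.exp (-(K * ((7 / 6 * x - Real.log (1 + 7 / 6 * x)) / 2))) ≤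
      Real.exp (-(K * (x ^ 2 / 6))) := by
    rw [Real.exp_le_exp, neg_le_neg_iff]
    refine mul_le_mul_of_nonneg_left ?_ (Nat.cast_nonneg K)
    have := third_sq_le_sub_log hx0 hx1
    linarith
  refine (unifProb_mono fun b hb => ?_).trans ((unifProb_or_le _ _).trans
    ((add_le_add hl (hu.trans hu')).trans_eq (two_mul _).symm))
  rwa [not_and_or, not_le, not_le] at hb

end Rademacher

/-! ### Sampling without replacement -/

/-- Along a uniform random permutation, products of a nonnegative weight over distinct points have
at most the average that independent sampling would give. -/
theorem expect_perm_prod_le {σ : Type*} [Fintype σ] [DecidableEq σ] [Nonempty σ] (w : σ → ℝ)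
    (hw : ∀ j, 0 ≤ w j) (T : Finset σ) :
    𝔼 p : Equiv.Perm σ, ∏ j ∈ T, w (p j) ≤ (𝔼 j, w j) ^ #T := by
  induction T using Finset.induction_on with
  | empty => simp
  | insert a T ha ih =>
    -- Composing with a transposition `(a j)` preserves the uniform law.
    have swp : ∀ (j : σ) (F : Equiv.Perm σ → ℝ),
        𝔼 p : Equiv.Perm σ, F p = 𝔼 p : Equiv.Perm σ, F (p * Equiv.swap a j) := fun j F =>
      Fintype.expect_equiv (Equiv.mulRight (Equiv.swap a j)⁻¹) _ _ (fun p => by simp)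
    have key : ∀ j, 𝔼 p : Equiv.Perm σ, w (p a) * ∏ i ∈ T, w (p i) ≤
        𝔼 p : Equiv.Perm σ, w (p j) * ∏ i ∈ T, w (p i) := by
      intro j
      by_cases hj : j ∈ T
      · -- Both sides carry the factor over `T \ {j}`; symmetrising leaves a square.
        set R : Equiv.Perm σ → ℝ := fun p => ∏ i ∈ T.erase j, w (p i) with hR
        have hRs : ∀ p : Equiv.Perm σ, R (p * Equiv.swap a j) = R p := by
          intro p
          refine prod_congr rfl fun i hi => ?_
          rw [Equiv.Perm.mul_apply, Equiv.swap_apply_of_ne_of_ne]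
          · rintro rfl; exact ha (mem_of_mem_erase hi)
          · exact ne_of_mem_erase hi
        have hT : ∀ p : Equiv.Perm σ, ∏ i ∈ T, w (p i) = w (p j) * R p := fun p =>
          (mul_prod_erase T (fun i => w (p i)) hj).symm
        have h1 : 𝔼 p : Equiv.Perm σ, w (p j) * (w (p j) * R p) =
            𝔼 p : Equiv.Perm σ, w (p a) * (w (p a) * R p) := by
          rw [swp j]
          simp [hRs]
        have h2 : 0 ≤ 𝔼 p : Equiv.Perm σ, (w (p a) - w (p j)) ^ 2 * R p :=
          expect_nonneg fun p _ => mul_nonneg (sq_nonneg _) (prod_nonneg fun i _ => hw _)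
        have h3 : 𝔼 p : Equiv.Perm σ, (w (p a) - w (p j)) ^ 2 * R p =
            𝔼 p : Equiv.Perm σ, w (p a) * (w (p a) * R p) -
              2 * (𝔼 p : Equiv.Perm σ, w (p a) * (w (p j) * R p)) +
              𝔼 p : Equiv.Perm σ, w (p j) * (w (p j) * R p) := by
          rw [mul_expect, ← expect_sub_distrib, ← expect_add_distrib]
          exact expect_congr rfl fun p _ => by ring
        simp only [hT]
        linarith
      · rw [swp j]
        refine le_of_eq (expect_congr rfl fun p _ => ?_)
        congr 1
        · simp
        · refine prod_congr rfl fun i hi => ?_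
          rw [Equiv.Perm.mul_apply, Equiv.swap_apply_of_ne_of_ne]
          · rintro rfl; exact ha hi
          · rintro rfl; exact hj hi
    simp only [prod_insert ha, card_insert_of_notMem ha]
    -- By `key` the new point `a` may be replaced by a uniform random point `j`, and `p j` is then
    -- uniform for every fixed `p`.
    calc 𝔼 p : Equiv.Perm σ, w (p a) * ∏ i ∈ T, w (p i)
        = 𝔼 _j : σ, 𝔼 p : Equiv.Perm σ, w (p a) * ∏ i ∈ T, w (p i) := by simp
      _ ≤ 𝔼 j : σ, 𝔼 p : Equiv.Perm σ, w (p j) * ∏ i ∈ T, w (p i) :=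
          expect_le_expect fun j _ => key j
      _ = 𝔼 p : Equiv.Perm σ, (𝔼 j, w j) * ∏ i ∈ T, w (p i) := by
          rw [expect_comm]
          refine expect_congr rfl fun p _ => ?_
          rw [← expect_mul]
          congr 1
          exact Fintype.expect_equiv p _ _ fun j => rfl
      _ ≤ (𝔼 j, w j) ^ (#T + 1) := by
          rw [← mul_expect, pow_succ']
          exact mul_le_mul_of_nonneg_left ih (expect_nonneg fun j _ => hw j)

/-- Hoeffding's comparison of sampling without and with replacement, for products of nonnegative
weights. -/
theorem expect_injective_prod_le {σ : Type*} [Fintype σ] [DecidableEq σ] [Nonempty σ] {K : ℕ}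
    (w : σ → ℝ) (hw : ∀ j, 0 ≤ w j) :
    𝔼 r : {r : Fin K → σ // Function.Injective r}, ∏ k, w (r.1 k) ≤ (𝔼 j, w j) ^ K := by
  classical
  have hm : 0 ≤ (𝔼 j, w j) ^ K := pow_nonneg (expect_nonneg fun j _ => hw j) K
  -- The law of a uniform random injection is invariant under permutations of the target.
  let act (p : Equiv.Perm σ) : {r : Fin K → σ // Function.Injective r} ≃
      {r : Fin K → σ // Function.Injective r} :=
    { toFun := fun r => ⟨p ∘ r.1, p.injective.comp r.2⟩
      invFun := fun r => ⟨p.symm ∘ r.1, p.symm.injective.comp r.2⟩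
      left_inv := fun r => by ext; simp
      right_inv := fun r => by ext; simp }
  calc 𝔼 r : {r : Fin K → σ // Function.Injective r}, ∏ k, w (r.1 k)
      = 𝔼 p : Equiv.Perm σ, 𝔼 r : {r : Fin K → σ // Function.Injective r},
          ∏ k, w (p (r.1 k)) := by
        rw [← Fintype.expect_const (ι := Equiv.Perm σ)
          (𝔼 r : {r : Fin K → σ // Function.Injective r}, ∏ k, w (r.1 k))]
        exact expect_congr rfl fun p _ => (Fintype.expect_equiv (act p) _ _ fun r => rfl).symm
    _ = 𝔼 r : {r : Fin K → σ // Function.Injective r}, 𝔼 p : Equiv.Perm σ,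
          ∏ k, w (p (r.1 k)) := expect_comm _ _ _
    _ ≤ 𝔼 _r : {r : Fin K → σ // Function.Injective r}, (𝔼 j, w j) ^ K := by
        refine expect_le_expect fun r _ => ?_
        have := expect_perm_prod_le w hw (univ.map ⟨r.1, r.2⟩)
        simpa using this
    _ ≤ (𝔼 j, w j) ^ K := by
        rcases isEmpty_or_nonempty {r : Fin K → σ // Function.Injective r} with h | h
        · simpa using hm
        · simp

/-- The Chernoff bound for sampling without replacement from numbers in `[0, M]` with mean one; the
two tails correspond to the two signs of `θ`. -/
theorem unifProb_sampling_tail {σ : Type*} [Fintype σ] [DecidableEq σ] [Nonempty σ] {K : ℕ}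
    (a : σ → ℝ) {M θ : ℝ} (hM : 0 < M) (ha0 : ∀ j, 0 ≤ a j) (haM : ∀ j, a j ≤ M)
    (hmean : 𝔼 j, a j = 1) (hθ : -1 < θ)
    (p : {r : Fin K → σ // Function.Injective r} → Prop)
    (hp : ∀ r, p r → 0 ≤ Real.log (1 + θ) * (∑ k, a (r.1 k) - K * (1 + θ))) :
    unifProb p ≤ Real.exp (-(K / M * ((1 + θ) * Real.log (1 + θ) - θ))) := by
  have h1 : 0 < 1 + θ := by linarith
  set ν := Real.log (1 + θ) / M with hν
  refine (unifProb_le_expect p (fun r => Real.exp (-(ν * (K * (1 + θ)))) *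
    ∏ k, Real.exp (ν * a (r.1 k))) (fun r => by positivity) (fun r hr => ?_)).trans ?_
  · rw [← Real.exp_sum, ← Real.exp_add, ← mul_sum]
    refine Real.one_le_exp ?_
    have := div_nonneg (hp r hr) hM.le
    have e : -(ν * (K * (1 + θ))) + ν * ∑ k, a (r.1 k) =
      Real.log (1 + θ) * (∑ k, a (r.1 k) - K * (1 + θ)) / M := by rw [hν]; ring
    rwa [e]
  · rw [← mul_expect]
    have h2 := expect_injective_prod_le (K := K) (fun j => Real.exp (ν * a j))
      (fun j => (Real.exp_pos _).le)
    have h3 : 𝔼 j, Real.exp (ν * a j) ≤ Real.exp (θ / M) := by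
      calc 𝔼 j, Real.exp (ν * a j) ≤ 𝔼 j, (1 + θ / M * a j) := by
            refine expect_le_expect fun j _ => ?_
            -- Bernoulli's inequality bounds the exponential by its chord on `[0, M]`.
            have := rpow_one_add_le_one_add_mul_self hθ.le
              (div_nonneg (ha0 j) hM.le) ((div_le_one hM).2 (haM j))
            rw [Real.rpow_def_of_pos h1] at this
            refine le_trans (le_of_eq ?_) (this.trans (le_of_eq ?_))
            · congr 1; rw [hν]; ring
            · ring
        _ = θ / M + 1 := by
            rw [expect_add_distrib, ← mul_expect, hmean]
            simp [add_comm]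
        _ ≤ _ := Real.add_one_le_exp _
    have h4 := h2.trans (pow_le_pow_left₀ (expect_nonneg fun _ _ => (Real.exp_pos _).le) h3 K)
    refine (mul_le_mul_of_nonneg_left h4 (Real.exp_pos _).le).trans (le_of_eq ?_)
    rw [← Real.exp_nat_mul, ← Real.exp_add]
    congr 1
    rw [hν]
    ring

theorem unifProb_sampling_distortion {σ : Type*} [Fintype σ] [DecidableEq σ] [Nonempty σ] {K : ℕ}
    (a : σ → ℝ) {M ε : ℝ} (hM : 0 < M) (ha0 : ∀ j, 0 ≤ a j) (haM : ∀ j, a j ≤ M)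
    (hmean : 𝔼 j, a j = 1) (hε0 : 0 < ε) (hε1 : ε < 1) :
    unifProb (fun r : {r : Fin K → σ // Function.Injective r} =>
      ¬ (K * (1 - ε) ≤ ∑ k, a (r.1 k) ∧ ∑ k, a (r.1 k) ≤ K * (1 + ε))) ≤
      2 * Real.exp (-(K / M * (ε ^ 2 / 2 - ε ^ 3 / 6))) := by
  have hKM : 0 ≤ K / M := by positivity
  have hu := unifProb_sampling_tail (K := K) (θ := ε) a hM ha0 haM hmean (by linarith)
    (fun r => K * (1 + ε) < ∑ k, a (r.1 k))
    (fun r hr => mul_nonneg (Real.log_nonneg (by linarith)) (by linarith))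
  have hl := unifProb_sampling_tail (K := K) (θ := -ε) a hM ha0 haM hmean (by linarith)
    (fun r => ∑ k, a (r.1 k) < K * (1 - ε))
    (fun r hr => mul_nonneg_of_nonpos_of_nonpos (Real.log_nonpos (by linarith) (by linarith))
      (by rw [← sub_eq_add_neg]; linarith))
  have hu' := hu.trans (Real.exp_le_exp.2 (neg_le_neg
    (mul_le_mul_of_nonneg_left (le_one_add_mul_log hε0.le) hKM)))
  have hl' := hl.trans (b := _) (c := Real.exp (-(K / M * (ε ^ 2 / 2 - ε ^ 3 / 6))))
    (Real.exp_le_exp.2 (neg_le_neg (mul_le_mul_of_nonneg_left (by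
      have := le_one_sub_mul_log hε1 hε0.le
      have := pow_pos hε0 3
      rw [← sub_eq_add_neg]
      linarith) hKM)))
  refine (unifProb_mono fun r hr => ?_).trans ((unifProb_or_le _ _).trans
    ((add_le_add hl' hu').trans_eq (two_mul _).symm))
  rwa [not_and_or, not_le, not_le] at hr

/-! ### Concentration of the randomised Hadamard sketch -/

section Hadamard

variable {ρ ι : Type*} [Fintype ρ] [Fintype ι] [DecidableEq ι]

/-- Sub-Gaussian tail of `‖B d‖` for a sign vector `d` and a matrix `B` of Frobenius norm one. -/
theorem unifProb_norm_tail (B : ρ → ι → ℝ) (hB : ∑ r, ∑ i, B r i ^ 2 = 1) {τ : ℝ} (hτ : 0 ≤ τ) :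
    unifProb (fun d : ι → Bool => (1 + τ) ^ 2 < ∑ r, (∑ i, B r i * sgn (d i)) ^ 2) ≤
      Real.exp (-(τ ^ 2 / 2)) := by
  have h := unifProb_quadratic_upper B hB 1 (a := 2 * τ + τ ^ 2) (by positivity)
  -- A single sign vector is a sign matrix with one column.
  have e : unifProb (fun d : ι → Bool => (1 + τ) ^ 2 < ∑ r, (∑ i, B r i * sgn (d i)) ^ 2) =
      unifProb (fun b : ι → Fin 1 → Bool =>
        (1 : ℕ) * (1 + (2 * τ + τ ^ 2)) < ∑ k, ∑ r, (∑ i, B r i * sgn (b i k)) ^ 2) := by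
    refine Fintype.expect_equiv (Equiv.piCongrRight fun _ => (Equiv.funUnique (Fin 1) Bool).symm)
      _ _ fun d => ?_
    have : 1 + (2 * τ + τ ^ 2) = (1 + τ) ^ 2 := by ring
    simp [this]
  rw [e]
  refine h.trans (Real.exp_le_exp.2 ?_)
  have h1 : 1 + (2 * τ + τ ^ 2) = (1 + τ) ^ 2 := by ring
  have h2 : Real.log (1 + τ) ≤ τ := by
    have := Real.log_le_sub_one_of_pos (show 0 < 1 + τ by linarith)
    linarith
  rw [h1, Real.log_pow]
  push_cast
  linarith

variable {H : Matrix ι ι ℝ}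

theorem isHadamard_sq (hH : H.IsHadamard) (j i : ι) : H j i ^ 2 = 1 := by
  have := (Unitary.mem_iff.1 (hH.apply_mem j i)).1
  simpa [sq] using this

/-- The columns of a Hadamard matrix are orthogonal of squared norm `s`. -/
theorem sum_sq_hadamard (hH : H.IsHadamard) (v : ι → ℝ) :
    ∑ j, (∑ i, v i * H j i) ^ 2 = Fintype.card ι * ∑ i, v i ^ 2 := by
  have h1 : ∀ j, ∑ i, v i * H j i = (H *ᵥ v) j := by
    intro j
    simp only [Matrix.mulVec, dotProduct]
    exact sum_congr rfl fun i _ => mul_comm _ _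
  have h2 : ∑ j, (H *ᵥ v) j ^ 2 = (H *ᵥ v) ⬝ᵥ (H *ᵥ v) := by
    simp [dotProduct, sq]
  simp only [h1]
  have h3 := hH.conjTranspose_mul
  rw [Matrix.conjTranspose_eq_transpose_of_trivial] at h3
  rw [h2, Matrix.dotProduct_mulVec, Matrix.vecMul_mulVec, h3]
  simp [dotProduct, sq, Matrix.vecMul_smul, mul_sum, mul_assoc]

/-- With high probability the random signs spread the squared norm evenly over the `s` columns of
the transformed matrix, up to a factor `(1 + τ) ^ 2`; the sampled columns then concentrate by the
Chernoff bound for sampling without replacement. -/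
theorem unifProb_srht_distortion (hH : H.IsHadamard) [Nonempty ι] (B : ρ → ι → ℝ)
    (hB : ∑ r, ∑ i, B r i ^ 2 = 1) (K : ℕ) {ε τ : ℝ} (hε0 : 0 < ε) (hε1 : ε < 1) (hτ : 0 ≤ τ) :
    unifProb (fun x : (ι → Bool) × {r : Fin K → ι // Function.Injective r} =>
      ¬ (K * (1 - ε) ≤ ∑ k, ∑ r, (∑ i, B r i * (H (x.2.1 k) i * sgn (x.1 i))) ^ 2 ∧
        ∑ k, ∑ r, (∑ i, B r i * (H (x.2.1 k) i * sgn (x.1 i))) ^ 2 ≤ K * (1 + ε))) ≤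
      Fintype.card ι * Real.exp (-(τ ^ 2 / 2)) +
        2 * Real.exp (-(K / (1 + τ) ^ 2 * (ε ^ 2 / 2 - ε ^ 3 / 6))) := by
  set a : (ι → Bool) → ι → ℝ := fun d j => ∑ r, (∑ i, B r i * (H j i * sgn (d i))) ^ 2 with ha
  refine (unifProb_prod_le _ (fun d => ∃ j, (1 + τ) ^ 2 < a d j)
    (c := 2 * Real.exp (-(K / (1 + τ) ^ 2 * (ε ^ 2 / 2 - ε ^ 3 / 6)))) (by positivity)
    fun d hd => ?_).trans (add_le_add ?_ le_rfl)
  · push Not at hd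
    refine unifProb_sampling_distortion (a d) (by positivity)
      (fun j => sum_nonneg fun r _ => sq_nonneg _) hd ?_ hε0 hε1
    have h1 : ∑ j, a d j = Fintype.card ι := by
      rw [ha, sum_comm]
      have h2 : ∀ r, ∑ j, (∑ i, B r i * (H j i * sgn (d i))) ^ 2 =
          Fintype.card ι * ∑ i, B r i ^ 2 := by
        intro r
        have := sum_sq_hadamard hH fun i => B r i * sgn (d i)
        simp only [mul_pow, sgn_sq, mul_one] at this
        rw [← this]
        refine sum_congr rfl fun j _ => ?_
        congr 1
        exact sum_congr rfl fun i _ => by ring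
      simp only [h2]
      rw [← mul_sum, hB, mul_one]
    rw [Fintype.expect_eq_sum_div_card, h1]
    exact div_self (by simp)
  · refine (unifProb_exists_le _).trans ?_
    calc ∑ j, unifProb (fun d => (1 + τ) ^ 2 < a d j) ≤ ∑ _j : ι, Real.exp (-(τ ^ 2 / 2)) := by
          refine sum_le_sum fun j _ => ?_
          have := unifProb_norm_tail (fun r i => B r i * H j i)
            (by simpa [mul_pow, isHadamard_sq hH] using hB) hτ
          simpa only [ha, mul_assoc] using this
      _ = _ := by simp

end Hadamard

/-! ### The sketching laws as images of uniform distributions -/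

theorem uniformOn_univ_le_unifProb {α : Type*} [Fintype α] [MeasurableSpace α]
    [MeasurableSingletonClass α] (p : α → Prop) :
    uniformOn Set.univ {x | p x} ≤ ENNReal.ofReal (unifProb p) := by
  classical
  rcases isEmpty_or_nonempty α with hα | hα
  · rw [Set.eq_empty_of_isEmpty {x | p x}]
    simp
  rw [uniformOn_univ, unifProb, Fintype.expect_eq_sum_div_card, sum_boole,
    ENNReal.ofReal_div_of_pos (by positivity), ENNReal.ofReal_natCast, ENNReal.ofReal_natCast]
  have : {x | p x} = ((univ.filter p : Finset α) : Set α) := by ext; simp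
  rw [this, Measure.count_apply_finset]

theorem signLaw_eq (c : ℝ) :
    signLaw c = (uniformOn Set.univ : Measure Bool).map fun b => sgn b * c := by
  have h : (uniformOn Set.univ : Measure Bool) =
      (2⁻¹ : ℝ≥0∞) • Measure.dirac true + (2⁻¹ : ℝ≥0∞) • Measure.dirac false := by
    refine Measure.ext_of_singleton fun b => ?_
    rw [uniformOn_univ]
    cases b <;> simp
  have hm : Measurable fun b : Bool => sgn b * c := measurable_from_top
  rw [h, Measure.map_add _ _ hm, Measure.map_smul, Measure.map_smul, Measure.map_dirac' hm,
    Measure.map_dirac' hm, signLaw, bernoulliMeasure_def]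
  have e1 : unitInterval.toNNReal ⟨1 / 2, by norm_num, by norm_num⟩ = 2⁻¹ := by
    ext; simp
  have e2 : unitInterval.toNNReal (unitInterval.symm ⟨1 / 2, by norm_num, by norm_num⟩) = 2⁻¹ := by
    ext; simp; norm_num
  rw [e1, e2]
  have e3 : ∀ ν : Measure ℝ, (2⁻¹ : NNReal) • ν = (2⁻¹ : ℝ≥0∞) • ν := by
    intro ν
    rw [ENNReal.smul_def, ENNReal.coe_inv two_ne_zero]
    simp
  simp [e3, sgn]

theorem pi_signLaw_eq {ι : Type*} [Fintype ι] (c : ℝ) :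
    (Measure.pi fun _ : ι => signLaw c) =
      (uniformOn Set.univ : Measure (ι → Bool)).map fun d i => sgn (d i) * c := by
  have hm : Measurable fun b : Bool => sgn b * c := measurable_from_top
  rw [← Set.pi_univ Set.univ, uniformOn_pi,
    Measure.pi_map_pi (f := fun _ b => sgn b * c) fun _ => hm.aemeasurable]
  simp only [signLaw_eq]

theorem rademacherLaw_eq (n K : ℕ) :
    rademacherLaw n K = (uniformOn Set.univ : Measure (Fin n → Fin K → Bool)).map
      fun b i k => sgn (b i k) * (√(K : ℝ))⁻¹ := by
  have hm : Measurable fun (d : Fin K → Bool) (k : Fin K) => sgn (d k) * (√(K : ℝ))⁻¹ :=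
    measurable_of_countable _
  rw [← Set.pi_univ Set.univ, uniformOn_pi,
    Measure.pi_map_pi (f := fun _ (d : Fin K → Bool) (k : Fin K) => sgn (d k) * (√(K : ℝ))⁻¹)
      fun _ => hm.aemeasurable]
  simp only [rademacherLaw, pi_signLaw_eq]

theorem uniformOn_eq_map_val {α : Type*} [Fintype α] [MeasurableSpace α]
    [MeasurableSingletonClass α] (S : Set α) :
    uniformOn S = (uniformOn Set.univ : Measure S).map Subtype.val := by
  classical
  refine Measure.ext_of_singleton fun x => ?_
  rw [Measure.map_apply measurable_subtype_coe (measurableSet_singleton x), uniformOn_univ,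
    uniformOn, cond_apply (Set.toFinite S).measurableSet, ENNReal.div_eq_inv_mul,
    Measure.count_apply_finite S (Set.toFinite S)]
  congr 1
  · congr 2
    rw [← Set.ncard_eq_toFinset_card S, ← Nat.card_coe_set_eq, Nat.card_eq_fintype_card]
  · by_cases hx : x ∈ S
    · have h1 : S ∩ {x} = {x} := by ext y; simp; rintro rfl; exact hx
      have h2 : (Subtype.val ⁻¹' {x} : Set S) = {⟨x, hx⟩} := by ext y; simp [Subtype.ext_iff]
      rw [h1, h2, Measure.count_singleton, Measure.count_singleton]
    · have h1 : S ∩ {x} = ∅ := by ext y; simp; rintro h rfl; exact hx h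
      have h2 : (Subtype.val ⁻¹' {x} : Set S) = ∅ := by
        ext y; simp; rintro rfl; exact hx y.2
      rw [h1, h2, measure_empty, measure_empty]

theorem uniformOn_univ_prod {α β : Type*} [Fintype α] [MeasurableSpace α]
    [MeasurableSingletonClass α] [Fintype β] [MeasurableSpace β] [MeasurableSingletonClass β] :
    (uniformOn Set.univ : Measure α).prod (uniformOn Set.univ : Measure β) =
      uniformOn Set.univ := by
  refine Measure.ext_of_singleton fun x => ?_
  rw [← Set.singleton_prod_singleton, Measure.prod_prod, Set.singleton_prod_singleton,
    uniformOn_univ, uniformOn_univ, uniformOn_univ]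
  simp only [Measure.count_singleton, Fintype.card_prod, Nat.cast_mul]
  rw [ENNReal.div_eq_inv_mul, ENNReal.div_eq_inv_mul, ENNReal.div_eq_inv_mul, mul_one, mul_one,
    mul_one, ENNReal.mul_inv (Or.inr (ENNReal.natCast_ne_top _)) (Or.inl (ENNReal.natCast_ne_top _))]

theorem psrhtLaw_eq (n K : ℕ) (H : Matrix (Fin (padSize n)) (Fin (padSize n)) ℝ) :
    psrhtLaw n K H = (uniformOn Set.univ : Measure ((Fin (padSize n) → Bool) ×
      {r : Fin K → Fin (padSize n) // Function.Injective r})).map fun x i k =>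
        (√(K : ℝ))⁻¹ * (H (x.2.1 k) (Fin.castLE (le_padSize n) i) *
          sgn (x.1 (Fin.castLE (le_padSize n) i))) := by
  have hm : Measurable fun (d : Fin (padSize n) → Bool) i => sgn (d i) * 1 :=
    measurable_of_countable _
  have h1 : (Measure.pi fun _ : Fin (padSize n) => signLaw 1).prod
      (uniformOn {r : Fin K → Fin (padSize n) | Function.Injective r}) =
      (uniformOn Set.univ : Measure ((Fin (padSize n) → Bool) ×
        {r : Fin K → Fin (padSize n) // Function.Injective r})).map
        (Prod.map (fun d i => sgn (d i) * 1) Subtype.val) := by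
    rw [pi_signLaw_eq, uniformOn_eq_map_val {r : Fin K → Fin (padSize n) | _},
      Measure.map_prod_map _ _ hm measurable_subtype_coe]
    congr 1
    exact uniformOn_univ_prod
  have hs : ∀ (d : Fin (padSize n) → ℝ) (r : Fin K → Fin (padSize n)) i k,
      srhtMatrix H d r i k = (√(K : ℝ))⁻¹ * (H (r k) i * d i) := by
    intro d r i k
    have : (1 : Matrix (Fin (padSize n)) (Fin (padSize n)) ℝ).submatrix r id * H =
        H.submatrix r id := by
      ext a b; simp [Matrix.mul_apply, Matrix.one_apply]
    simp [srhtMatrix, this, mul_comm]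
  have hm2 : Measurable fun (p : (Fin (padSize n) → ℝ) × (Fin K → Fin (padSize n))) i k =>
      srhtMatrix H p.1 p.2 i k := by
    simp only [hs]
    refine measurable_pi_lambda _ fun i => measurable_pi_lambda _ fun k => ?_
    have : Measurable fun j => H j i := measurable_of_countable _
    fun_prop
  rw [psrhtLaw, srhtLaw, h1, Measure.map_map hm2 (measurable_of_countable _),
    Measure.map_map (by fun_prop) (measurable_of_countable _)]
  congr 1
  ext x i k
  simp [hs]

/-! ### Nets of the unit sphere -/

section Net

variable {E : Type*} [NormedAddCommGroup E] [NormedSpace ℝ E] [FiniteDimensional ℝ E]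

open Module Metric in
/-- Volume bound: the balls of radius `η / 2` around the points are disjoint and lie in the ball of
radius `1 + η / 2`. -/
theorem card_le_of_separated {η : ℝ} (hη : 0 < η) (s : Finset E) (hs : ∀ c ∈ s, ‖c‖ ≤ 1)
    (h : ∀ c ∈ s, ∀ d ∈ s, c ≠ d → η ≤ ‖c - d‖) :
    (#s : ℝ) ≤ (1 + 2 / η) ^ finrank ℝ E := by
  borelize E
  let μ : Measure E := Measure.addHaar
  have hη2 : 0 < η / 2 := by positivity
  have hρ : 0 < 1 + η / 2 := by positivity
  have D : Set.Pairwise (s : Set E) (Function.onFun Disjoint fun c => ball (c : E) (η / 2)) := by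
    rintro c hc d hd hcd
    apply ball_disjoint_ball
    rw [dist_eq_norm]
    linarith [h c hc d hd hcd]
  have hsub : (⋃ c ∈ s, ball (c : E) (η / 2)) ⊆ ball (0 : E) (1 + η / 2) := by
    refine Set.iUnion₂_subset fun x hx => ball_subset_ball' ?_
    rw [dist_zero_right]
    linarith [hs x hx]
  have I : (#s : ℝ≥0∞) * ENNReal.ofReal ((η / 2) ^ finrank ℝ E) * μ (ball 0 1) ≤
      ENNReal.ofReal ((1 + η / 2) ^ finrank ℝ E) * μ (ball 0 1) :=
    calc _ = μ (⋃ c ∈ s, ball (c : E) (η / 2)) := by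
          rw [measure_biUnion_finset D fun c _ => measurableSet_ball]
          simp only [μ.addHaar_ball_of_pos _ hη2, sum_const, nsmul_eq_mul, mul_assoc]
      _ ≤ μ (ball (0 : E) (1 + η / 2)) := measure_mono hsub
      _ = _ := μ.addHaar_ball_of_pos _ hρ
  have J := (ENNReal.mul_le_mul_iff_left (measure_ball_pos _ _ zero_lt_one).ne'
    measure_ball_lt_top.ne).1 I
  have J2 := ENNReal.toReal_le_of_le_ofReal (by positivity) J
  rw [ENNReal.toReal_mul, ENNReal.toReal_natCast, ENNReal.toReal_ofReal (by positivity),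
    ← le_div_iff₀ (by positivity), ← div_pow] at J2
  refine J2.trans (le_of_eq ?_)
  congr 1
  field_simp
  ring

open Module in
theorem exists_finset_net_sphere {η : ℝ} (hη : 0 < η) :
    ∃ N : Finset E, (∀ y ∈ N, ‖y‖ = 1) ∧ (∀ x : E, ‖x‖ = 1 → ∃ y ∈ N, ‖x - y‖ ≤ η) ∧
      (#N : ℝ) ≤ (1 + 2 / η) ^ finrank ℝ E := by
  classical
  -- A separated set of maximal cardinality is a net.
  let P : ℕ → Prop := fun k => ∃ s : Finset E, #s = k ∧ (∀ y ∈ s, ‖y‖ = 1) ∧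
    ∀ c ∈ s, ∀ d ∈ s, c ≠ d → η ≤ ‖c - d‖
  have hbdd : ∀ k, P k → k ≤ ⌊(1 + 2 / η) ^ finrank ℝ E⌋₊ := by
    rintro k ⟨s, rfl, hs1, hs2⟩
    exact Nat.le_floor (card_le_of_separated hη s (fun c hc => (hs1 c hc).le) hs2)
  have h0 : P 0 := ⟨∅, by simp⟩
  obtain ⟨N, hcard, hN1, hN2⟩ := Nat.findGreatest_spec (Nat.zero_le _) h0
    (n := ⌊(1 + 2 / η) ^ finrank ℝ E⌋₊)
  refine ⟨N, hN1, fun x hx => ?_, card_le_of_separated hη N (fun c hc => (hN1 c hc).le) hN2⟩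
  by_contra! hfar
  have hxN : x ∉ N := fun hxN => by
    have := hfar x hxN
    simp at this
    linarith
  have hP : P (#N + 1) := by
    refine ⟨insert x N, card_insert_of_notMem hxN, ?_, ?_⟩
    · intro y hy
      rcases mem_insert.1 hy with rfl | hy
      exacts [hx, hN1 y hy]
    · intro c hc d hd hcd
      rcases mem_insert.1 hc with hc' | hc' <;> rcases mem_insert.1 hd with hd' | hd'
      · exact absurd (hc'.trans hd'.symm) hcd
      · rw [hc']; exact (hfar d hd').le
      · rw [hd', norm_sub_rev]; exact (hfar c hc').le
      · exact hN2 c hc' d hd' hcd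
  have := Nat.le_findGreatest (hbdd _ hP) hP
  omega

/-- Two-sided control of a linear map on a net of the unit sphere gives a lower bound everywhere:
the upper control on the net bounds the operator norm, which pays for the distance to the net. -/
theorem lower_bound_of_net {F : Type*} [NormedAddCommGroup F] [NormedSpace ℝ F] (T : E →ₗ[ℝ] F)
    {η a b : ℝ} (hη0 : 0 ≤ η) (hη1 : η < 1) (ha : 0 ≤ a) (N : Finset E)
    (hN : ∀ x : E, ‖x‖ = 1 → ∃ y ∈ N, ‖x - y‖ ≤ η) (hup : ∀ y ∈ N, ‖T y‖ ≤ a)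
    (hlow : ∀ y ∈ N, b ≤ ‖T y‖) (x : E) :
    (b - a / (1 - η) * η) * ‖x‖ ≤ ‖T x‖ := by
  set S : E →L[ℝ] F := T.toContinuousLinearMap with hS
  have hST : ∀ x, S x = T x := fun x => rfl
  have h1η : 0 < 1 - η := by linarith
  have hS1 : ‖S‖ ≤ a + ‖S‖ * η := by
    refine ContinuousLinearMap.opNorm_le_of_unit_norm (by positivity) fun x hx => ?_
    obtain ⟨y, hy, hxy⟩ := hN x hx
    have h1 : S x = S y + S (x - y) := by rw [map_sub]; abel
    calc ‖S x‖ ≤ ‖S y‖ + ‖S (x - y)‖ := by rw [h1]; exact norm_add_le _ _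
      _ ≤ a + ‖S‖ * η := add_le_add (hup y hy)
          ((S.le_opNorm _).trans (mul_le_mul_of_nonneg_left hxy (norm_nonneg _)))
  have hSL : ‖S‖ ≤ a / (1 - η) := by
    rw [le_div_iff₀ h1η]
    linarith
  rcases eq_or_ne x 0 with rfl | hx0
  · simp
  have hxn : 0 < ‖x‖ := norm_pos_iff.2 hx0
  obtain ⟨y, hy, hxy⟩ := hN (‖x‖⁻¹ • x) (by rw [norm_smul, norm_inv, norm_norm,
    inv_mul_cancel₀ hxn.ne'])
  have h2 : b - a / (1 - η) * η ≤ ‖S (‖x‖⁻¹ • x)‖ := by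
    have h1 : S y = S (‖x‖⁻¹ • x) - S (‖x‖⁻¹ • x - y) := by rw [map_sub]; abel
    have h3 : ‖S y‖ ≤ ‖S (‖x‖⁻¹ • x)‖ + ‖S (‖x‖⁻¹ • x - y)‖ := by
      rw [h1]; exact norm_sub_le _ _
    have h4 : ‖S (‖x‖⁻¹ • x - y)‖ ≤ a / (1 - η) * η :=
      (S.le_opNorm _).trans (mul_le_mul hSL hxy (norm_nonneg _) (by positivity))
    have := hlow y hy
    rw [← hST] at this
    linarith
  rw [map_smul, norm_smul, norm_inv, norm_norm, hST, inv_mul_eq_div, le_div_iff₀ hxn] at h2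
  exact h2

end Net

/-- The constants: distortion `[1 - β, 1 + α]` on a net of mesh `ε / (3 C)` is enough for the
quasi-optimality constant `√((1 + ε') / (1 - ε'))`. -/
theorem quasi_optimality_constant {ε C ε' α β : ℝ} (hε : 0 < ε) (hC : 1 < C)
    (hε'_def : ε' = ε * (C + 1) / (C - 1)) (hε' : ε' < 1) (hα : 0 ≤ α) (hβ0 : 0 ≤ β)
    (hαβ : (1 + α) * (1 - ε) ≤ (1 + ε) * (1 - β)) :
    0 < √(1 - β) - √(1 + α) / (1 - ε / (3 * C)) * (ε / (3 * C)) ∧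
    √(1 + α) ≤ √((1 + ε') / (1 - ε')) *
      (√(1 - β) - √(1 + α) / (1 - ε / (3 * C)) * (ε / (3 * C))) := by
  have hC1 : 0 < C - 1 := by linarith
  have hC0 : 0 < C := by linarith
  obtain ⟨κ, hκ⟩ : ∃ κ, κ = 2 * ε / (C - 1) := ⟨_, rfl⟩
  have hεκ : ε' = ε + κ := by rw [hε'_def, hκ]; field_simp; ring
  have hκ0 : 0 < κ := by rw [hκ]; positivity
  set η := ε / (3 * C) with hη
  have hη0 : 0 < η := by positivity
  have hηκ : 6 * η ≤ κ := by
    have : 6 * η = 2 * ε / C := by rw [hη]; field_simp; ring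
    rw [this, hκ]
    exact div_le_div_of_nonneg_left (by positivity) hC1 (by linarith)
  have hsum : ε + κ < 1 := by linarith
  have hD : 0 < 1 - ε' := by linarith
  set a := √(1 + α) with ha
  set b := √(1 - β) with hb
  have ha2 : a ^ 2 = 1 + α := Real.sq_sqrt (by linarith)
  have ha1 : 1 ≤ a := Real.one_le_sqrt.2 (by linarith)
  have hq0 : 0 ≤ 1 - β := by
    by_contra hneg
    have : (1 + ε) * (1 - β) < 0 := mul_neg_of_pos_of_neg (by linarith) (by linarith)
    have : 0 ≤ (1 + α) * (1 - ε) := mul_nonneg (by linarith) (by linarith)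
    linarith
  have hb2 : b ^ 2 = 1 - β := Real.sq_sqrt hq0
  have hb0 : 0 ≤ b := Real.sqrt_nonneg _
  have hb1 : b ≤ 1 := Real.sqrt_le_one.2 (by linarith)
  obtain ⟨l, hl⟩ : ∃ l, l = a / (1 - η) * η := ⟨_, rfl⟩
  rw [← hl]
  have hl0 : 0 ≤ l := by
    rw [hl]
    have : 0 < 1 - η := by linarith
    positivity
  have hl1 : l ≤ a * κ / 5 := by
    rw [hl, div_mul_eq_mul_div, div_le_div_iff₀ (by linarith) (by norm_num)]
    have h1 : 5 * η ≤ κ * (1 - η) := by nlinarith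
    have h2 := mul_le_mul_of_nonneg_left h1 (by linarith : 0 ≤ a)
    linarith
  rw [← ha2, ← hb2] at hαβ
  have hpos : l < b := by
    refine lt_of_pow_lt_pow_left₀ 2 hb0 ?_
    have h1 : l ^ 2 ≤ (a * κ / 5) ^ 2 := pow_le_pow_left₀ hl0 hl1 2
    have h2 : a ^ 2 * κ ≤ a ^ 2 * (1 - ε) := mul_le_mul_of_nonneg_left (by linarith) (sq_nonneg a)
    have h3 : a ^ 2 * κ ^ 2 ≤ a ^ 2 * κ := mul_le_mul_of_nonneg_left (by nlinarith) (sq_nonneg a)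
    have h4 : 0 < a ^ 2 * κ := by positivity
    have h5 : (1 + ε) * b ^ 2 ≤ 2 * b ^ 2 :=
      mul_le_mul_of_nonneg_right (by linarith) (sq_nonneg b)
    nlinarith
  refine ⟨by linarith, ?_⟩
  -- Passing from `ε` to `ε' = ε + κ` gains `2 a² κ` after clearing denominators, while the mesh
  -- costs at most `2 b l ≤ (2 / 5) a κ` times `(1 + ε) (1 + ε') ≤ 4`.
  have key : a ^ 2 * (1 - ε') ≤ (1 + ε') * (b - l) ^ 2 := by
    have h1 : b ^ 2 - 2 / 5 * a * κ ≤ (b - l) ^ 2 := by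
      have : b * l ≤ 1 * (a * κ / 5) := mul_le_mul hb1 hl1 hl0 zero_le_one
      nlinarith [sq_nonneg l]
    have h2 : (1 + ε) * (a ^ 2 * (1 - ε')) ≤ (1 + ε) * ((1 + ε') * (b ^ 2 - 2 / 5 * a * κ)) := by
      have h3 : (1 + ε') * (a ^ 2 * (1 - ε)) ≤ (1 + ε') * ((1 + ε) * b ^ 2) :=
        mul_le_mul_of_nonneg_left hαβ (by linarith)
      have h4 : (1 + ε) * (1 + ε') ≤ 2 * 2 :=
        mul_le_mul (by linarith) (by linarith) (by linarith) (by norm_num)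
      have h5 : (1 + ε) * (1 + ε') * (2 / 5 * a * κ) ≤ 2 * 2 * (2 / 5 * a * κ) :=
        mul_le_mul_of_nonneg_right h4 (by positivity)
      have h6 : a * κ ≤ a ^ 2 * κ := mul_le_mul_of_nonneg_right (by nlinarith) hκ0.le
      have h7 : (1 + ε) * (a ^ 2 * (1 - ε')) =
          (1 + ε') * (a ^ 2 * (1 - ε)) - 2 * (a ^ 2 * κ) := by rw [hεκ]; ring
      nlinarith
    have h3 := le_of_mul_le_mul_left h2 (by linarith)
    exact h3.trans (mul_le_mul_of_nonneg_left h1 (by linarith))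
  have hbl : 0 ≤ b - l := by linarith
  rw [← Real.sqrt_sq hbl, ← Real.sqrt_mul (div_nonneg (by linarith) hD.le)]
  refine Real.le_sqrt_of_sq_le ?_
  rw [div_mul_eq_mul_div, le_div_iff₀ hD]
  exact key

/-- Best approximation from the image of a subspace under a linear map exists. -/
theorem exists_norm_sub_map_le {E F : Type*} [NormedAddCommGroup E] [NormedSpace ℝ E]
    [NormedAddCommGroup F] [NormedSpace ℝ F] [FiniteDimensional ℝ F] (Y : Submodule ℝ E)
    (T : E →ₗ[ℝ] F) (x : F) : ∃ P ∈ Y, ∀ Q ∈ Y, ‖x - T P‖ ≤ ‖x - T Q‖ := by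
  have : ProperSpace F := FiniteDimensional.proper ℝ F
  obtain ⟨_, ⟨P, hP, rfl⟩, h⟩ := (Submodule.closed_of_finiteDimensional
    (Y.map T)).exists_infDist_eq_dist (Y.map T).nonempty x
  refine ⟨P, hP, fun Q hQ => ?_⟩
  rw [← dist_eq_norm, ← dist_eq_norm, ← h]
  exact Metric.infDist_le_dist_of_mem ⟨Q, hQ, rfl⟩

/-! ### Distortion of a fixed matrix under the two sketching laws -/

theorem frobenius_norm_sq {ρ κ : Type*} [Fintype ρ] [Fintype κ] (M : Matrix ρ κ ℝ) :
    ‖M‖ ^ 2 = ∑ i, ∑ j, M i j ^ 2 := by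
  have h0 : 0 ≤ ∑ i, ∑ j, M i j ^ 2 := sum_nonneg fun i _ => sum_nonneg fun j _ => sq_nonneg _
  rw [Matrix.frobenius_norm_def]
  simp only [Real.rpow_two, Real.norm_eq_abs, sq_abs]
  rw [← Real.sqrt_eq_rpow, Real.sq_sqrt h0]

/-- The sketch of size `n × K` with entries `W` distorts the squared Frobenius norm of `X` by
factors in `[lo, hi]`. -/
def SketchBounds {n K : ℕ} (lo hi : ℝ) (X : Matrix (Fin n) (Fin n) ℝ) (W : Fin n → Fin K → ℝ) :
    Prop :=
  lo * ‖X‖ ^ 2 ≤ ‖X * Matrix.of W‖ ^ 2 ∧ ‖X * Matrix.of W‖ ^ 2 ≤ hi * ‖X‖ ^ 2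

section Fixed

variable {n K : ℕ} {lo hi : ℝ}

theorem measurableSet_sketchBounds (X : Matrix (Fin n) (Fin n) ℝ) :
    MeasurableSet {W : Fin n → Fin K → ℝ | ¬ SketchBounds lo hi X W} := by
  have hm : Measurable fun W : Fin n → Fin K → ℝ => ‖X * Matrix.of W‖ ^ 2 := by
    simp only [frobenius_norm_sq, Matrix.mul_apply, Matrix.of_apply]
    fun_prop
  exact ((measurableSet_le measurable_const hm).inter
    (measurableSet_le hm measurable_const)).compl

theorem sketchBounds_zero (W : Fin n → Fin K → ℝ) : SketchBounds lo hi 0 W := by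
  simp [SketchBounds]

theorem sum_sq_normalized {X : Matrix (Fin n) (Fin n) ℝ} (hX : X ≠ 0) :
    ∑ r, ∑ i, (X r i / ‖X‖) ^ 2 = 1 := by
  have : ‖X‖ ≠ 0 := norm_ne_zero_iff.2 hX
  simp only [div_pow, ← sum_div]
  rw [← frobenius_norm_sq]
  exact div_self (pow_ne_zero 2 this)

theorem sketchBounds_iff (hK : 0 < K) {X : Matrix (Fin n) (Fin n) ℝ} (hX : X ≠ 0)
    (w : Fin n → Fin K → ℝ) :
    SketchBounds lo hi X (fun i k => (√(K : ℝ))⁻¹ * w i k) ↔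
      K * lo ≤ ∑ k, ∑ r, (∑ i, X r i / ‖X‖ * w i k) ^ 2 ∧
        ∑ k, ∑ r, (∑ i, X r i / ‖X‖ * w i k) ^ 2 ≤ K * hi := by
  have hX0 : 0 < ‖X‖ := norm_pos_iff.2 hX
  have hK0 : (0 : ℝ) < K := Nat.cast_pos.2 hK
  have hKs : √(K : ℝ) ^ 2 = K := Real.sq_sqrt hK0.le
  have key : ‖X * Matrix.of fun i k => (√(K : ℝ))⁻¹ * w i k‖ ^ 2 =
      ‖X‖ ^ 2 * (∑ k, ∑ r, (∑ i, X r i / ‖X‖ * w i k) ^ 2) / K := by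
    rw [frobenius_norm_sq, sum_comm, mul_sum, sum_div]
    refine sum_congr rfl fun k _ => ?_
    rw [mul_sum, sum_div]
    refine sum_congr rfl fun r _ => ?_
    rw [Matrix.mul_apply, ← mul_pow, ← hKs, ← div_pow, mul_sum, sum_div]
    congr 1
    refine sum_congr rfl fun i _ => ?_
    rw [Matrix.of_apply]
    field_simp
    rw [hKs]
  rw [SketchBounds, key, le_div_iff₀ hK0, div_le_iff₀ hK0]
  have hX2 : 0 < ‖X‖ ^ 2 := by positivity
  refine and_congr ?_ ?_
  · rw [show lo * ‖X‖ ^ 2 * K = ‖X‖ ^ 2 * (K * lo) by ring, mul_le_mul_iff_right₀ hX2]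
  · rw [show hi * ‖X‖ ^ 2 * K = ‖X‖ ^ 2 * (K * hi) by ring, mul_le_mul_iff_right₀ hX2]

theorem rademacherLaw_distortion (hK : 0 < K) {x : ℝ} (hx0 : 0 ≤ x) (hx1 : x ≤ 1)
    (X : Matrix (Fin n) (Fin n) ℝ) :
    rademacherLaw n K {W | ¬ SketchBounds (1 - x * (5 + x) / 6) (1 + 7 / 6 * x) X W} ≤
      ENNReal.ofReal (2 * Real.exp (-(K * (x ^ 2 / 6)))) := by
  rcases eq_or_ne X 0 with rfl | hX
  · simp [sketchBounds_zero]
  rw [rademacherLaw_eq, Measure.map_apply (measurable_of_countable _)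
    (measurableSet_sketchBounds X)]
  refine (uniformOn_univ_le_unifProb _).trans (ENNReal.ofReal_le_ofReal ?_)
  refine le_trans (le_of_eq ?_)
    (unifProb_rademacher_distortion (fun r i => X r i / ‖X‖) (sum_sq_normalized hX) K hx0 hx1)
  congr 1
  ext b
  refine not_congr (Iff.trans (Iff.of_eq (congrArg (SketchBounds _ _ X) ?_))
    (sketchBounds_iff hK hX fun i k => sgn (b i k)))
  ext i k
  exact mul_comm _ _

theorem padSize_le_two_mul (hn : 0 < n) : padSize n ≤ 2 * n := by
  rcases Nat.lt_or_ge 1 n with h | h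
  · have h1 := Nat.pow_pred_clog_lt_self one_lt_two h
    have h2 : 0 < Nat.clog 2 n := Nat.clog_pos one_lt_two h
    obtain ⟨c, hc⟩ := Nat.exists_eq_succ_of_ne_zero h2.ne'
    rw [hc, Nat.pred_succ] at h1
    rw [padSize, hc, Nat.succ_eq_add_one, pow_succ]
    omega
  · obtain rfl : n = 1 := by omega
    simp [padSize]

theorem psrhtLaw_distortion (hn : 0 < n) (hK : 0 < K)
    {H : Matrix (Fin (padSize n)) (Fin (padSize n)) ℝ} (hH : H.IsHadamard) {ε τ : ℝ}
    (hε0 : 0 < ε) (hε1 : ε < 1) (hτ : 0 ≤ τ) (X : Matrix (Fin n) (Fin n) ℝ) :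
    psrhtLaw n K H {W | ¬ SketchBounds (1 - ε) (1 + ε) X W} ≤
      ENNReal.ofReal (2 * n * Real.exp (-(τ ^ 2 / 2)) +
        2 * Real.exp (-(K / (1 + τ) ^ 2 * (ε ^ 2 / 2 - ε ^ 3 / 6)))) := by
  rcases eq_or_ne X 0 with rfl | hX
  · simp [sketchBounds_zero]
  have hne : Nonempty (Fin (padSize n)) := ⟨⟨0, hn.trans_le (le_padSize n)⟩⟩
  rw [psrhtLaw_eq, Measure.map_apply (measurable_of_countable _) (measurableSet_sketchBounds X)]
  refine (uniformOn_univ_le_unifProb _).trans (ENNReal.ofReal_le_ofReal ?_)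
  -- The rows of the normalised matrix, padded with zeros to length `padSize n`.
  have hinj : Function.Injective (Fin.castLE (le_padSize n)) := Fin.castLE_injective _
  set B : Fin n → Fin (padSize n) → ℝ := fun r =>
    Function.extend (Fin.castLE (le_padSize n)) (fun i => X r i / ‖X‖) 0 with hBdef
  have hBe : ∀ r i, B r (Fin.castLE (le_padSize n) i) = X r i / ‖X‖ := fun r i =>
    hinj.extend_apply _ _ _
  have hB0 : ∀ r j, j ∉ Set.range (Fin.castLE (le_padSize n)) → B r j = 0 := fun r j hj =>
    Function.extend_apply' _ _ _ hj
  have hB : ∑ r, ∑ j, B r j ^ 2 = 1 := by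
    rw [← sum_sq_normalized hX]
    refine sum_congr rfl fun r _ => (Fintype.sum_of_injective _ hinj _ _ (fun j hj => ?_)
      fun i => ?_).symm
    · simp [hB0 r j hj]
    · rw [hBe]
  have h := unifProb_srht_distortion hH B hB K hε0 hε1 hτ
  refine le_trans (le_of_eq ?_) (h.trans (add_le_add (mul_le_mul_of_nonneg_right ?_
    (Real.exp_pos _).le) le_rfl))
  · congr 1
    ext x
    refine not_congr ((sketchBounds_iff hK hX fun i k =>
      H (x.2.1 k) (Fin.castLE (le_padSize n) i) * sgn (x.1 (Fin.castLE (le_padSize n) i))).trans ?_)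
    have : ∀ r k, ∑ i, X r i / ‖X‖ * (H (x.2.1 k) (Fin.castLE (le_padSize n) i) *
        sgn (x.1 (Fin.castLE (le_padSize n) i))) =
        ∑ j, B r j * (H (x.2.1 k) j * sgn (x.1 j)) := fun r k =>
      Fintype.sum_of_injective _ hinj _ _ (fun j hj => by simp [hB0 r j hj])
        fun i => by rw [hBe]
    simp only [this]
  · rw [Fintype.card_fin]
    exact_mod_cast padSize_le_two_mul hn

end Fixed

/-! ### From one matrix to a finite-dimensional space of matrices -/

theorem log_pos_and_exp_neg_log {Z : ℝ} (hZ : 1 < Z) :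
    0 < Real.log Z ∧ Real.exp (-Real.log Z) = Z⁻¹ :=
  ⟨Real.log_pos hZ, by rw [Real.exp_neg, Real.exp_log (by linarith)]⟩

/-- Under either sampling condition, a fixed matrix is distorted by more than the admissible
amount with probability at most `δ / N`. For Rademacher sketches the lower tail has room to spare,
and the interval of admissible distortions is shifted upwards accordingly. -/
theorem exists_sketchBounds_le {n K : ℕ} (hn : 0 < n) {ε δ N : ℝ} (hε : 0 < ε) (hε1 : ε < 1)
    (hδ : 0 < δ) (hδ1 : δ < 1) (hN : 1 ≤ N)
    {Ω : Type*} [MeasurableSpace Ω] (μ : Measure Ω) (V : Ω → Matrix (Fin n) (Fin K) ℝ)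
    (hV :
      (IsRademacherMatrix μ V ∧ 6 * ε⁻¹ ^ 2 * Real.log (2 * n * N / δ) ≤ (K : ℝ)) ∨
      (IsPSRHTMatrix μ V ∧
        2 * (ε ^ 2 - ε ^ 3 / 3)⁻¹ * Real.log (4 * N / δ) *
          (1 + √(8 * Real.log (4 * n * N / δ))) ^ 2 ≤ (K : ℝ))) :
    ∃ α β : ℝ, 0 ≤ α ∧ 0 ≤ β ∧ (1 + α) * (1 - ε) ≤ (1 + ε) * (1 - β) ∧
      ∀ X : Matrix (Fin n) (Fin n) ℝ,
        μ {ω | ¬ SketchBounds (1 - β) (1 + α) X (fun i k => V ω i k)} ≤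
          ENNReal.ofReal (δ / N) := by
  have hn1 : (1 : ℝ) ≤ n := by exact_mod_cast hn
  have hNpos : 0 < N := by linarith
  have hnN : 1 ≤ n * N := one_le_mul_of_one_le_of_one_le hn1 hN
  have big : ∀ c : ℝ, 2 ≤ c → 1 < c / δ := fun c hc => by
    rw [lt_div_iff₀ hδ]; linarith
  rcases hV with ⟨hV, hK⟩ | ⟨⟨H, hH, hV⟩, hK⟩
  · obtain ⟨hlog, hexp⟩ := log_pos_and_exp_neg_log (big (2 * n * N) (by linarith))
    have hKpos : 0 < K := by
      have : (0 : ℝ) < K := lt_of_lt_of_le (by positivity) hK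
      exact_mod_cast this
    refine ⟨7 / 6 * ε, ε * (5 + ε) / 6, by positivity, by positivity, ?_, fun X => ?_⟩
    · have : 0 ≤ ε ^ 2 * (1 - ε) := mul_nonneg (sq_nonneg _) (by linarith)
      nlinarith
    · rw [hV.measure_eq (measurableSet_sketchBounds X)]
      refine (rademacherLaw_distortion hKpos hε.le hε1.le X).trans (ENNReal.ofReal_le_ofReal ?_)
      have h1 : Real.log (2 * n * N / δ) ≤ K * (ε ^ 2 / 6) := by
        have := mul_le_mul_of_nonneg_right hK (show 0 ≤ ε ^ 2 / 6 by positivity)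
        refine le_trans (le_of_eq ?_) this
        field_simp
      calc 2 * Real.exp (-(K * (ε ^ 2 / 6))) ≤ 2 * (2 * n * N / δ)⁻¹ := by
            rw [← hexp]
            exact mul_le_mul_of_nonneg_left (Real.exp_le_exp.2 (neg_le_neg h1)) zero_le_two
        _ = δ / (n * N) := by field_simp
        _ ≤ δ / N := div_le_div_of_nonneg_left hδ.le hNpos (le_mul_of_one_le_left hNpos.le hn1)
  · obtain ⟨hlog1, hexp1⟩ := log_pos_and_exp_neg_log (big (4 * N) (by linarith))
    obtain ⟨hlog2, hexp2⟩ := log_pos_and_exp_neg_log (big (4 * n * N) (by linarith))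
    have hden : 0 < ε ^ 2 - ε ^ 3 / 3 := by
      have : ε ^ 2 - ε ^ 3 / 3 = ε ^ 2 * (1 - ε / 3) := by ring
      rw [this]
      exact mul_pos (by positivity) (by linarith)
    set τ := √(8 * Real.log (4 * n * N / δ)) with hτ
    have hτ0 : 0 ≤ τ := Real.sqrt_nonneg _
    have hτ2 : τ ^ 2 = 8 * Real.log (4 * n * N / δ) := Real.sq_sqrt (by positivity)
    have hM : 0 < (1 + τ) ^ 2 := by positivity
    have hKpos : 0 < K := by
      have : (0 : ℝ) < K := lt_of_lt_of_le (by positivity) hK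
      exact_mod_cast this
    refine ⟨ε, ε, hε.le, hε.le, le_of_eq (mul_comm _ _ |>.trans (by ring)), fun X => ?_⟩
    rw [hV.measure_eq (measurableSet_sketchBounds X)]
    refine (psrhtLaw_distortion hn hKpos hH hε hε1 hτ0 X).trans (ENNReal.ofReal_le_ofReal ?_)
    have h1 : Real.log (4 * N / δ) ≤ K / (1 + τ) ^ 2 * (ε ^ 2 / 2 - ε ^ 3 / 6) := by
      rw [div_mul_eq_mul_div, le_div_iff₀ hM]
      have := mul_le_mul_of_nonneg_right hK hden.le
      have e : 2 * (ε ^ 2 - ε ^ 3 / 3)⁻¹ * Real.log (4 * N / δ) * (1 + τ) ^ 2 *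
          (ε ^ 2 - ε ^ 3 / 3) = 2 * (Real.log (4 * N / δ) * (1 + τ) ^ 2) := by
        linear_combination 2 * Real.log (4 * N / δ) * (1 + τ) ^ 2 * inv_mul_cancel₀ hden.ne'
      rw [e] at this
      linarith
    have h2 : Real.exp (-(τ ^ 2 / 2)) ≤ (4 * n * N / δ)⁻¹ := by
      rw [← hexp2, hτ2]
      exact Real.exp_le_exp.2 (by linarith)
    have h3 : Real.exp (-(K / (1 + τ) ^ 2 * (ε ^ 2 / 2 - ε ^ 3 / 6))) ≤ (4 * N / δ)⁻¹ := by
      rw [← hexp1]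
      exact Real.exp_le_exp.2 (neg_le_neg h1)
    calc _ ≤ 2 * n * (4 * n * N / δ)⁻¹ + 2 * (4 * N / δ)⁻¹ :=
          add_le_add (mul_le_mul_of_nonneg_left h2 (by positivity))
            (mul_le_mul_of_nonneg_left h3 zero_le_two)
      _ = δ / N := by field_simp; norm_num

/-- If the sketch obeys the distortion bounds at the minimal residual `Xs` and on a net of the unit
sphere of a space containing all residuals, any residual with smaller sketched norm than `Xs` is
quasi-optimal. -/
theorem norm_le_of_sketchBounds {n K : ℕ} {ε C ε' α β : ℝ} (hε : 0 < ε) (hC : 1 < C)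
    (hε'_def : ε' = ε * (C + 1) / (C - 1)) (hε' : ε' < 1) (hα : 0 ≤ α) (hβ : 0 ≤ β)
    (hαβ : (1 + α) * (1 - ε) ≤ (1 + ε) * (1 - β))
    {S : Submodule ℝ (Matrix (Fin n) (Fin n) ℝ)} (N : Finset S) (hN1 : ∀ y ∈ N, ‖y‖ = 1)
    (hN : ∀ x : S, ‖x‖ = 1 → ∃ y ∈ N, ‖x - y‖ ≤ ε / (3 * C))
    (V : Matrix (Fin n) (Fin K) ℝ)
    (hNV : ∀ y ∈ N, SketchBounds (1 - β) (1 + α) y.1 (fun i k => V i k))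
    {X Xs : Matrix (Fin n) (Fin n) ℝ} (hX : X ∈ S)
    (hXs : SketchBounds (1 - β) (1 + α) Xs (fun i k => V i k)) (hle : ‖X * V‖ ≤ ‖Xs * V‖) :
    ‖X‖ ≤ √((1 + ε') / (1 - ε')) * ‖Xs‖ := by
  obtain ⟨hpos, hcst⟩ := quasi_optimality_constant hε hC hε'_def hε' hα hβ hαβ
  have hV : (Matrix.of fun i k => V i k) = V := rfl
  simp only [SketchBounds, hV] at hNV hXs
  have hη : ε / (3 * C) < 1 := by
    rw [div_lt_one (by linarith)]
    have : ε ≤ ε' := by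
      rw [hε'_def, le_div_iff₀ (by linarith)]
      exact mul_le_mul_of_nonneg_left (by linarith) hε.le
    linarith
  set T : S →ₗ[ℝ] Matrix (Fin n) (Fin K) ℝ :=
    { toFun := fun x => x.1 * V
      map_add' := fun x y => Matrix.add_mul _ _ _
      map_smul' := fun c x => Matrix.smul_mul _ _ _ } with hT
  have hTy : ∀ y, T y = y.1 * V := fun y => rfl
  have hlow := lower_bound_of_net T (η := ε / (3 * C)) (a := √(1 + α)) (b := √(1 - β))
    (div_nonneg hε.le (by linarith)) hη (Real.sqrt_nonneg _) N hN
    (fun y hy => Real.le_sqrt_of_sq_le (by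
      have := (hNV y hy).2
      have h1 : ‖y.1‖ = 1 := hN1 y hy
      rw [h1] at this
      simpa [hTy] using this))
    (fun y hy => Real.sqrt_le_iff.2 ⟨norm_nonneg _, by
      have := (hNV y hy).1
      have h1 : ‖y.1‖ = 1 := hN1 y hy
      rw [h1] at this
      simpa [hTy] using this⟩) ⟨X, hX⟩
  have hup : ‖Xs * V‖ ≤ √(1 + α) * ‖Xs‖ := by
    rw [← Real.sqrt_sq (norm_nonneg Xs), ← Real.sqrt_mul (by linarith)]
    exact Real.le_sqrt_of_sq_le hXs.2
  have h1 : (√(1 - β) - √(1 + α) / (1 - ε / (3 * C)) * (ε / (3 * C))) * ‖X‖ ≤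
      (√(1 - β) - √(1 + α) / (1 - ε / (3 * C)) * (ε / (3 * C))) *
        (√((1 + ε') / (1 - ε')) * ‖Xs‖) := by
    refine hlow.trans (hle.trans (hup.trans ?_))
    refine (mul_le_mul_of_nonneg_right hcst (norm_nonneg Xs)).trans (le_of_eq ?_)
    ring
  exact le_of_mul_le_mul_left h1 hpos

/-- The sketched functional always attains its minimum over the subspace. -/
theorem exists_isSemiFrobProjection {n K : ℕ} (Y : Submodule ℝ (Matrix (Fin n) (Fin n) ℝ))
    (A : Matrix (Fin n) (Fin n) ℝ) (V : Matrix (Fin n) (Fin K) ℝ) :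
    ∃ P, IsSemiFrobProjection Y A V P := by
  obtain ⟨P, hP, h⟩ := exists_norm_sub_map_le Y
    ({ toFun := fun P => P * A * V
       map_add' := fun P Q => by simp [Matrix.add_mul]
       map_smul' := fun c P => by simp } :
      Matrix (Fin n) (Fin n) ℝ →ₗ[ℝ] Matrix (Fin n) (Fin K) ℝ) V
  refine ⟨P, hP, fun Q hQ => ?_⟩
  have := h Q hQ
  simpa [Matrix.sub_mul] using this

theorem exists_isFrobProjection {n : ℕ} (Y : Submodule ℝ (Matrix (Fin n) (Fin n) ℝ))
    (A : Matrix (Fin n) (Fin n) ℝ) : ∃ P, IsFrobProjection Y A P := by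
  obtain ⟨P, hP, h⟩ := exists_isSemiFrobProjection Y A (1 : Matrix (Fin n) (Fin n) ℝ)
  exact ⟨P, hP, by simpa using h⟩

/-- All residuals `I - P A(ξ)` with `P` in the interpolation space lie in a space of dimension at
most `m + 1`. -/
theorem exists_residual_space {Ξ : Type*} {n m : ℕ} (A : Ξ → Matrix (Fin n) (Fin n) ℝ)
    (pts : Fin m → Ξ) (ξ : Ξ) :
    ∃ S : Submodule ℝ (Matrix (Fin n) (Fin n) ℝ), Module.finrank ℝ S ≤ m + 1 ∧
      ∀ P ∈ interpSpace A pts, 1 - P * A ξ ∈ S := by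
  set g : Fin (m + 1) → Matrix (Fin n) (Fin n) ℝ :=
    Fin.cons 1 fun i => (A (pts i))⁻¹ * A ξ with hg
  refine ⟨Submodule.span ℝ (Set.range g), (finrank_range_le_card (R := ℝ) g).trans (by simp),
    fun P hP => Submodule.sub_mem _ (Submodule.subset_span ⟨0, rfl⟩) ?_⟩
  refine Submodule.span_induction (p := fun P _ => P * A ξ ∈ Submodule.span ℝ (Set.range g))
    ?_ ?_ ?_ ?_ hP
  · rintro _ ⟨i, rfl⟩
    exact Submodule.subset_span ⟨i.succ, rfl⟩
  · simp
  · intro P Q _ _ hP hQ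
    rw [Matrix.add_mul]
    exact Submodule.add_mem _ hP hQ
  · intro c P _ hP
    rw [Matrix.smul_mul]
    exact Submodule.smul_mem _ _ hP

end RandomSketch

theorem mainTheorem1 {Ξ : Type*} {n m K : ℕ} (hn : 0 < n)
    (A : Ξ → Matrix (Fin n) (Fin n) ℝ) (pts : Fin m → Ξ) (hA : ∀ i, IsUnit (A (pts i))) (ξ : Ξ)
    (ε δ C ε' : ℝ) (hε : 0 < ε) (hε1 : ε ≤ 1) (hδ : 0 < δ) (hC : 1 < C)
    (hε'_def : ε' = ε * (C + 1) / (C - 1)) (hε' : ε' < 1)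
    {Ω : Type*} [MeasurableSpace Ω] (μ : Measure Ω) [IsProbabilityMeasure μ]
    (V : Ω → Matrix (Fin n) (Fin K) ℝ)
    (hV :
      (IsRademacherMatrix μ V ∧
        6 * ε⁻¹ ^ 2 * Real.log (2 * n * (9 * C / ε) ^ (m + 1) / δ) ≤ (K : ℝ)) ∨
      (IsPSRHTMatrix μ V ∧
        2 * (ε ^ 2 - ε ^ 3 / 3)⁻¹ * Real.log (4 * (9 * C / ε) ^ (m + 1) / δ) *
          (1 + √(8 * Real.log (4 * n * (9 * C / ε) ^ (m + 1) / δ))) ^ 2 ≤ (K : ℝ))) :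
    ∃ Pstar, IsFrobProjection (interpSpace A pts) (A ξ) Pstar ∧
      ENNReal.ofReal (1 - δ) ≤
        μ {ω | (∃ P, IsSemiFrobProjection (interpSpace A pts) (A ξ) (V ω) P) ∧
          ∀ P, IsSemiFrobProjection (interpSpace A pts) (A ξ) (V ω) P →
            ‖1 - P * A ξ‖ ≤ √((1 + ε') / (1 - ε')) * ‖1 - Pstar * A ξ‖} := by
  classical
  obtain ⟨Pstar, hPs⟩ := RandomSketch.exists_isFrobProjection (interpSpace A pts) (A ξ)
  refine ⟨Pstar, hPs, ?_⟩
  -- For `1 ≤ δ` the probability bound is trivial; below, all logarithms are positive.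
  rcases le_or_gt 1 δ with hδ1 | hδ1
  · rw [ENNReal.ofReal_of_nonpos (by linarith)]
    exact zero_le
  have hε1' : ε < 1 := by
    refine lt_of_le_of_lt ?_ hε'
    rw [hε'_def, le_div_iff₀ (by linarith)]
    exact mul_le_mul_of_nonneg_left (by linarith) hε.le
  have hCε : 1 ≤ C / ε := by rw [le_div_iff₀ hε]; linarith
  have h9 : 9 * C / ε = 9 * (C / ε) := by ring
  have hN1 : 1 ≤ (9 * C / ε) ^ (m + 1) := one_le_pow₀ (by rw [h9]; linarith)
  obtain ⟨α, β, hα, hβ, hαβ, hfix⟩ :=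
    RandomSketch.exists_sketchBounds_le hn hε hε1' hδ hδ1 hN1 μ V hV
  obtain ⟨S, hSdim, hS⟩ := RandomSketch.exists_residual_space A pts ξ
  have hη : 0 < ε / (3 * C) := div_pos hε (by linarith)
  obtain ⟨N, hNu, hNnet, hNcard⟩ := RandomSketch.exists_finset_net_sphere (E := S) hη
  set T : Finset (Matrix (Fin n) (Fin n) ℝ) :=
    insert (1 - Pstar * A ξ) (N.image Subtype.val) with hT
  have hTcard : (T.card : ℝ) ≤ (9 * C / ε) ^ (m + 1) := by
    have h1 : (T.card : ℝ) ≤ N.card + 1 := by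
      exact_mod_cast (Finset.card_insert_le _ _).trans
        (Nat.add_le_add_right Finset.card_image_le 1)
    have h2 : 2 / (ε / (3 * C)) = 6 * (C / ε) := by field_simp; ring
    rw [h2] at hNcard
    have h3 : (1 + 6 * (C / ε)) ^ Module.finrank ℝ S ≤ (1 + 6 * (C / ε)) ^ (m + 1) :=
      pow_le_pow_right₀ (by linarith) hSdim
    -- One more element for the optimal residual.
    have h4 : (1 + 6 * (C / ε)) ^ (m + 1) + 1 ≤ (1 + 6 * (C / ε) + 1) ^ (m + 1) := by
      have := pow_add_pow_le (show 0 ≤ 1 + 6 * (C / ε) by linarith) zero_le_one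
        (Nat.succ_ne_zero m)
      simpa using this
    have h5 : (1 + 6 * (C / ε) + 1) ^ (m + 1) ≤ (9 * C / ε) ^ (m + 1) :=
      pow_le_pow_left₀ (by linarith) (by rw [h9]; linarith) _
    linarith
  set bad : Set Ω := {ω | ∃ X ∈ T,
    ¬ RandomSketch.SketchBounds (1 - β) (1 + α) X (fun i k => V ω i k)} with hbad
  have hbadμ : μ bad ≤ ENNReal.ofReal δ := by
    have h1 : bad = ⋃ X ∈ T,
        {ω | ¬ RandomSketch.SketchBounds (1 - β) (1 + α) X (fun i k => V ω i k)} := by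
      ext ω; simp [hbad]
    rw [h1]
    refine (measure_biUnion_finset_le T _).trans ((Finset.sum_le_sum fun X _ => hfix X).trans ?_)
    rw [Finset.sum_const, nsmul_eq_mul, ← ENNReal.ofReal_natCast,
      ← ENNReal.ofReal_mul (Nat.cast_nonneg _)]
    refine ENNReal.ofReal_le_ofReal ?_
    rw [mul_div_assoc', div_le_iff₀ (by linarith), mul_comm]
    exact mul_le_mul_of_nonneg_left hTcard hδ.le
  have hgood : badᶜ ⊆ {ω | (∃ P, IsSemiFrobProjection (interpSpace A pts) (A ξ) (V ω) P) ∧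
      ∀ P, IsSemiFrobProjection (interpSpace A pts) (A ξ) (V ω) P →
        ‖1 - P * A ξ‖ ≤ √((1 + ε') / (1 - ε')) * ‖1 - Pstar * A ξ‖} := by
    intro ω hω
    have hω' : ∀ X ∈ T,
        RandomSketch.SketchBounds (1 - β) (1 + α) X (fun i k => V ω i k) := by
      intro X hX
      by_contra h
      exact hω ⟨X, hX, h⟩
    refine ⟨RandomSketch.exists_isSemiFrobProjection _ _ _, fun P hP => ?_⟩
    exact RandomSketch.norm_le_of_sketchBounds hε hC hε'_def hε' hα hβ hαβ N hNu hNnet (V ω)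
      (fun y hy => hω' _ (Finset.mem_insert_of_mem (Finset.mem_image_of_mem _ hy)))
      (hS P hP.1) (hω' _ (Finset.mem_insert_self _ _)) (hP.2 Pstar hPs.1)
  refine le_trans ?_ (measure_mono hgood)
  -- Subadditivity suffices, so that no measurability of `bad` is needed.
  have h1 : (1 : ℝ≥0∞) ≤ μ bad + μ badᶜ := by
    rw [← measure_univ (μ := μ), ← Set.union_compl_self bad]
    exact measure_union_le _ _
  rw [ENNReal.ofReal_sub _ hδ.le, ENNReal.ofReal_one]
  exact tsub_le_iff_left.2 (h1.trans (add_le_add hbadμ le_rfl))
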